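/- For an interval $I=(c,d)$ with $-\infty<c<d<\infty$ write $\langle f\rangle_I=\frac1{|I|}\int_I f$. For a bounded interval $Q$ of positive length let $\mathrm{BMO}(Q)$ be the set of real functions $\varphi\in L^1(Q)$ for which $$\|\varphi\|_{\mathrm{BMO}(Q)}=\sup_{J\subset Q}\big(\langle\varphi^2\rangle_J-\langle\varphi\rangle_J^2\big)^{1/2}<\infty,$$ the supremum being over all intervals $J\subset Q$ of positive length. **Theorem.** Fix such an interval $Q=(a,b)$ and numbers $p_1\in[1,2]$ and $p_2\in[2,\infty)$. Then, for every $\varphi\in\mathrm{BMO}(Q)$, the averages below are finite and $$\langle|\varphi-\langle\varphi\rangle_Q|^{p_1}\rangle_Q^{p_2/p_1}\le\langle|\varphi-\langle\varphi\rangle_Q|^{p_2}\rangle_Q\le\frac{p_2\Gamma(p_2)}{p_1\Gamma(p_1)}\,\|\varphi\|_{\mathrm{BMO}(Q)}^{p_2-p_1}\,\langle|\varphi-\langle\varphi\rangle_Q|^{p_1}\rangle_Q$$ (with the convention $0^0=1$). Both inequalities are sharp: in the left one the constant $1$ in front of the left-hand side cannot be replaced by a larger one, and in the right one the constant $\frac{p_2\Gamma(p_2)}{p_1\Gamma(p_1)}$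 cannot be replaced by a smaller one. Both are attained: for every $\varepsilon>0$ the functions $x\mapsto\varphi_k\big(\frac{x-a}{b-a}\big)$, $k=1,2$, where $$\varphi_1(t)=\begin{cases}-\varepsilon,&0<t<\frac12,\\ \varepsilon,&\frac12\le t<1,\end{cases}\qquad \varphi_2(t)=\begin{cases}\varepsilon\log(4t),&0<t<\frac14,\\ 0,&\frac14\le t\le\frac34,\\ -\varepsilon\log(4-4t),&\frac34<t<1,\end{cases}$$ belong to $\mathrm{BMO}(Q)$ and have $\mathrm{BMO}(Q)$-norm $\varepsilon$; the first gives equality in the left inequality and the second gives equality in the right inequality. -/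

import Mathlib

open MeasureTheory

noncomputable section

/-- The average `⟨f⟩` of a function over the interval `(c, d)` with respect to Lebesgue measure. -/
def intervalAv (f : ℝ → ℝ) (c d : ℝ) : ℝ :=
  ⨍ x in Set.Ioo c d, f x

/-- `φ ∈ BMO(Q)` for the interval `Q = (a, b)`: `φ ∈ L¹(Q)`, and for some `C` we have
`⟨φ²⟩_J - ⟨φ⟩_J² ≤ C² < ∞` for every subinterval `J = (c, d)` of `Q`. The integrability of `φ²`
on `J` says that `⟨φ²⟩_J` is finite. -/
def MemBMO (φ : ℝ → ℝ) (a b : ℝ) : Prop :=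
  IntegrableOn φ (Set.Ioo a b) ∧
    ∃ C : ℝ, ∀ c d : ℝ, a ≤ c → c < d → d ≤ b →
      IntegrableOn (fun x => φ x ^ 2) (Set.Ioo c d) ∧
        intervalAv (fun x => φ x ^ 2) c d - intervalAv φ c d ^ 2 ≤ C ^ 2

/-- The norm of `φ` in `BMO((a, b))`: the supremum of `(⟨φ²⟩_J - ⟨φ⟩_J²)^{1/2}` over all
subintervals `J = (c, d)` of `(a, b)`, that is, the least admissible `C ≥ 0` above. -/
def bmoNorm (φ : ℝ → ℝ) (a b : ℝ) : ℝ :=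
  sSup {r : ℝ | ∃ c d : ℝ, a ≤ c ∧ c < d ∧ d ≤ b ∧
    r = Real.sqrt (intervalAv (fun x => φ x ^ 2) c d - intervalAv φ c d ^ 2)}

/-- The integrand `|φ - ⟨φ⟩_Q|^p` of the `p`-oscillation over `Q = (a, b)`. -/
def oscFun (p : ℝ) (φ : ℝ → ℝ) (a b : ℝ) : ℝ → ℝ :=
  fun x => |φ x - intervalAv φ a b| ^ p

/-- The `p`-oscillation `⟨|φ - ⟨φ⟩_Q|^p⟩_Q` over `Q = (a, b)`. -/
def osc (p : ℝ) (φ : ℝ → ℝ) (a b : ℝ) : ℝ :=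
  intervalAv (oscFun p φ a b) a b

/-- The two-valued function on `(0, 1)`. -/
def stepOptimizer (ε : ℝ) (t : ℝ) : ℝ :=
  if t < 1 / 2 then -ε else ε

/-- The logarithmic function on `(0, 1)`. -/
def logOptimizer (ε : ℝ) (t : ℝ) : ℝ :=
  if t < 1 / 4 then ε * Real.log (4 * t)
  else if t ≤ 3 / 4 then 0
  else -(ε * Real.log (4 - 4 * t))

/-- Transport of a function on `(0, 1)` to `(a, b)` by the increasing affine change of variable. -/
def onInterval (ψ : ℝ → ℝ) (a b : ℝ) : ℝ → ℝ :=
  fun x => ψ ((x - a) / (b - a))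

end

/-! The left inequality is Jensen's. For the right one, subtract the mean and let ε be a positive
bound for the norm. Everything rests on one estimate: if the mean of φ over (a, b) is at most t + ε,
then ∫(φ-t)₊² ≤ 2ε∫(φ-t)₊ (`VarianceLE.integral_sq_posPart_le`). A rising-sun argument on the
primitive of φ-(t+ε) splits (a, b), up to a null set, into a set where φ ≤ t+ε, on which the
estimate is pointwise, and intervals where the mean of φ is exactly t+ε, on which it is the variance
bound.

Applied to φ and -φ, it says that G(t) = ∫(|φ|-t)₊² satisfies G' ≤ -G/ε, hence G(t) ≤ e^{-t/ε}G(0).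
A standard exponential variable has truncated second moment exactly 2e^{-t}, so scaled by ε it is
the extremal case.

Powers are mixtures of truncated squares: y^p is a multiple of ∫t^{p-3}(y-t)₊²dt for p > 2, and of
∫t^{p-3}(y²-(y-t)₊²)dt for 1 < p < 2. Integrating the decay of G, and comparing with the exponential
law to identify the constant, gives ∫|φ|^p ≤ (Γ(p+1)/2)ε^{p-2}∫φ² for p ≥ 2 and the reverse for 1 ≤
p ≤ 2. Eliminating the second moment between p₁ and p₂ gives the theorem, since pΓ(p) = Γ(p+1).

For sharpness, the two-valued function has constant modulus. The modulus of the logarithmic one is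
zero on half of the interval and exponentially distributed on the other half, so its moments are
ε^pΓ(p+1)/2. -/

/-! ### A rising-sun decomposition of the line. -/

/-- The integral over an open set is nonpositive if it is so over each of its components. -/
lemma setIntegral_nonpos_of_components {U : Set ℝ} {g : ℝ → ℝ} (hU : IsOpen U)
    (hbd : Bornology.IsBounded U) (hg : IntegrableOn g U)
    (h : ∀ c d, c < d → Set.Ioo c d ⊆ U → c ∉ U → d ∉ U → ∫ x in Set.Ioo c d, g x ≤ 0) :
    ∫ x in U, g x ≤ 0 := by
  set S : Set (Set ℝ) := Set.range fun x : U => connectedComponentIn U x with hS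
  have hopen : ∀ s ∈ S, IsOpen s := by
    rintro _ ⟨x, rfl⟩
    exact hU.connectedComponentIn
  have hdisj : S.PairwiseDisjoint id := by
    rintro _ ⟨x, rfl⟩ _ ⟨y, rfl⟩ hne
    refine Set.disjoint_left.2 fun z hz hz' => hne ?_
    exact (connectedComponentIn_eq hz).trans (connectedComponentIn_eq hz').symm
  have hne : ∀ s ∈ S, s.Nonempty := by
    rintro _ ⟨x, rfl⟩
    exact ⟨x, mem_connectedComponentIn x.2⟩
  have hcount : S.Countable := hdisj.countable_of_isOpen hopen hne
  have hunion : ⋃ s : S, (s : Set ℝ) = U := by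
    ext z
    simp only [Set.mem_iUnion]
    constructor
    · rintro ⟨⟨_, ⟨x, rfl⟩⟩, hz⟩
      exact connectedComponentIn_subset _ _ hz
    · intro hz
      exact ⟨⟨_, ⟨⟨z, hz⟩, rfl⟩⟩, mem_connectedComponentIn hz⟩
  have : Countable S := hcount.to_subtype
  rw [← hunion, integral_iUnion (fun s : S => (hopen s s.2).measurableSet)
    (fun s t hst => hdisj s.2 t.2 fun e => hst (Subtype.ext e)) (by rwa [hunion])]
  refine tsum_nonpos fun s => ?_
  obtain ⟨_, ⟨x, rfl⟩⟩ := s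
  set J := connectedComponentIn U (x : ℝ) with hJ
  have hJU : J ⊆ U := connectedComponentIn_subset _ _
  have hJo : IsOpen J := hU.connectedComponentIn
  have hxJ : (x : ℝ) ∈ J := mem_connectedComponentIn x.2
  have hJb : Bornology.IsBounded J := hbd.subset hJU
  have hbb := hJb.bddBelow
  have hba := hJb.bddAbove
  have hIoo : Set.Ioo (sInf J) (sSup J) ⊆ J :=
    (isConnected_connectedComponentIn_iff.2 x.2).Ioo_csInf_csSup_subset hbb hba
  -- By maximality of components, a point of U adherent to J lies in J. The endpoints of J are
  -- adherent but not in J, so they lie outside U.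
  have hmemJ : ∀ z ∈ U, z ∈ closure J → z ∈ J := by
    intro z hz hzc
    obtain ⟨w, hw, hwJ⟩ := mem_closure_iff.1 hzc _ hU.connectedComponentIn
      (mem_connectedComponentIn hz)
    rw [hJ, connectedComponentIn_eq hwJ, ← connectedComponentIn_eq hw]
    exact mem_connectedComponentIn hz
  have hinf : sInf J ∉ J := fun hm => by
    obtain ⟨l, hl, hlJ⟩ := exists_Ioc_subset_of_mem_nhds (hJo.mem_nhds hm) ⟨sInf J - 1, by simp⟩
    obtain ⟨z, hz, hz'⟩ := exists_between hl
    exact absurd (csInf_le hbb (hlJ ⟨hz, hz'.le⟩)) (not_le.2 hz')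
  have hsup : sSup J ∉ J := fun hm => by
    obtain ⟨l, hl, hlJ⟩ := exists_Ico_subset_of_mem_nhds (hJo.mem_nhds hm) ⟨sSup J + 1, by simp⟩
    obtain ⟨z, hz, hz'⟩ := exists_between hl
    exact absurd (le_csSup hba (hlJ ⟨hz.le, hz'⟩)) (not_le.2 hz)
  have hsub : J ⊆ Set.Ioo (sInf J) (sSup J) := fun z hz =>
    ⟨lt_of_le_of_ne (csInf_le hbb hz) fun e => hinf (e ▸ hz),
      lt_of_le_of_ne (le_csSup hba hz) fun e => hsup (e ▸ hz)⟩
  have hJe : J = Set.Ioo (sInf J) (sSup J) := hsub.antisymm hIoo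
  show ∫ x in J, g x ≤ 0
  rw [hJe]
  refine h _ _ ((hsub hxJ).1.trans (hsub hxJ).2) (hIoo.trans hJU) (fun hc => hinf ?_)
    (fun hd => hsup ?_)
  · exact hmemJ _ hc (csInf_mem_closure ⟨_, hxJ⟩ hbb)
  · exact hmemJ _ hd (csSup_mem_closure ⟨_, hxJ⟩ hba)

/-- The points of `[a, b]` at which `F` agrees with `max (inf_{[a, x]} F) (F b)`. -/
def contactSet (F : ℝ → ℝ) (a b : ℝ) : Set ℝ :=
  {x | a ≤ x ∧ x ≤ b ∧ F b ≤ F x ∧ ∀ y, a ≤ y → x ≤ y ∨ F x ≤ max (F y) (F b)}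

/-- The disjunction `x ≤ y ∨ …` turns the running infimum into an intersection, over fixed y, of
closed conditions on x. -/
lemma isClosed_contactSet {F : ℝ → ℝ} (hF : Continuous F) (a b : ℝ) :
    IsClosed (contactSet F a b) := by
  have : contactSet F a b = {x | a ≤ x} ∩ ({x | x ≤ b} ∩ ({x | F b ≤ F x} ∩
      ⋂ y, ⋂ _ : a ≤ y, ({x | x ≤ y} ∪ {x | F x ≤ max (F y) (F b)}))) := by
    ext x
    simp [contactSet]
  rw [this]
  refine isClosed_Ici.inter (isClosed_Iic.inter ((isClosed_le continuous_const hF).inter ?_))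
  exact isClosed_iInter fun y => isClosed_iInter fun _ =>
    isClosed_Iic.union (isClosed_le hF continuous_const)

lemma left_mem_contactSet {F : ℝ → ℝ} {a b : ℝ} (hab : a ≤ b) (h : F b ≤ F a) :
    a ∈ contactSet F a b :=
  ⟨le_rfl, hab, h, fun _ hy => Or.inl hy⟩

lemma right_mem_contactSet {F : ℝ → ℝ} {a b : ℝ} (hab : a ≤ b) : b ∈ contactSet F a b :=
  ⟨hab, le_rfl, le_rfl, fun _ _ => Or.inr (le_max_right _ _)⟩

/-- F d ≤ F c because d is a contact point to the right of c. If F dropped strictly, then for v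
strictly between the two values the first point of [c, d] where F reaches v would be a new running
minimum above F b, that is, a contact point inside the gap. -/
lemma eq_of_contactSet_gap {F : ℝ → ℝ} (hF : Continuous F) {a b c d : ℝ} (hcd : c < d)
    (hc : c ∈ contactSet F a b) (hd : d ∈ contactSet F a b)
    (hgap : ∀ x ∈ Set.Ioo c d, x ∉ contactSet F a b) : F c = F d := by
  obtain ⟨hac, hcb, hcF, hcy⟩ := hc
  obtain ⟨had, hdb, hdF, hdy⟩ := hd
  have hle : F d ≤ F c := by
    rcases hdy c hac with h | h
    · exact absurd h (not_le.2 hcd)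
    · rwa [max_eq_left hcF] at h
  refine (hle.eq_or_lt.resolve_right fun hlt => ?_).symm
  obtain ⟨v, hv1, hv2⟩ := exists_between hlt
  set T : Set ℝ := Set.Icc c d ∩ {z | F z ≤ v} with hT
  have hTc : IsCompact T := isCompact_Icc.inter_right (isClosed_le hF continuous_const)
  have hTne : T.Nonempty := ⟨d, ⟨hcd.le, le_rfl⟩, hv1.le⟩
  have hz : sInf T ∈ T := hTc.sInf_mem hTne
  set z := sInf T with hzdef
  have hbefore : ∀ y, c ≤ y → y < z → v < F y := fun y hy hyz => by
    by_contra hcon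
    exact absurd (csInf_le hTc.bddBelow ⟨⟨hy, (hyz.trans_le hz.1.2).le⟩, not_lt.1 hcon⟩)
      (not_le.2 hyz)
  have hcz : c < z := lt_of_le_of_ne hz.1.1 fun e => by
    have := hz.2
    rw [← e] at this
    exact absurd this (not_le.2 hv2)
  have hzv : F z = v := by
    refine le_antisymm hz.2 ?_
    have hmem : z ∈ closure (Set.Ioo c z) := by
      rw [closure_Ioo hcz.ne]; exact ⟨hcz.le, le_rfl⟩
    have hcl : IsClosed {y | v ≤ F y} := isClosed_le continuous_const hF
    exact closure_minimal (fun y hy => (hbefore y hy.1.le hy.2).le) hcl hmem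
  have hzd : z < d := lt_of_le_of_ne hz.1.2 fun e => by
    rw [e] at hzv
    exact absurd hzv hv1.ne
  refine hgap z ⟨hcz, hzd⟩ ⟨hac.trans hcz.le, hzd.le.trans hdb, ?_, fun y hy => ?_⟩
  · rw [hzv]; exact hdF.trans hv1.le
  · rcases le_or_gt z y with h | h
    · exact Or.inl h
    right
    rw [hzv]
    rcases le_or_gt c y with h' | h'
    · exact (hbefore y h' h).le.trans (le_max_left _ _)
    · rcases hcy y hy with h'' | h''
      · exact absurd h'' (not_le.2 h')
      · exact hv2.le.trans h''

/-- Where F' > 0, F is smaller just to the left, so x is not a running minimum and contact forces F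
x = F b. F then exceeds F b just to the right, so x is isolated from the right in that level set,
and such points are countable. -/
lemma countable_contactSet_deriv_pos (F : ℝ → ℝ) (a b : ℝ) :
    {x | x ∈ contactSet F a b ∧ x < b ∧ a < x ∧ ∃ m, 0 < m ∧ HasDerivAt F m x}.Countable := by
  refine (countable_setOfPred_isolated_right_within (s := {x | F x = F b})).mono ?_
  rintro x ⟨⟨hax, hxb, hFx, hy⟩, hxb', hax', m, hm, hd⟩
  have hslope := hasDerivAt_iff_tendsto_slope.1 hd
  have hpos : ∀ᶠ y in nhdsWithin x {x}ᶜ, 0 < slope F x y := hslope.eventually_const_lt hm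
  rw [eventually_nhdsWithin_iff] at hpos
  obtain ⟨l, u, ⟨hl, hu⟩, hlu⟩ := mem_nhds_iff_exists_Ioo_subset.1 hpos
  have hslope' : ∀ y ∈ Set.Ioo l u, y ≠ x → 0 < (F y - F x) / (y - x) := fun y hy hne => by
    have := hlu hy hne
    rwa [slope_def_field] at this
  have heq : F x = F b := by
    obtain ⟨y, hy1, hy2⟩ := exists_between (max_lt hl hax')
    have h1 := hslope' y ⟨(le_max_left _ _).trans_lt hy1, hy2.trans hu⟩ hy2.ne
    have h2 : F y < F x := by
      by_contra hcon
      exact absurd h1 (not_lt.2 (div_nonpos_of_nonneg_of_nonpos (by linarith) (by linarith)))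
    rcases hy y ((le_max_right _ _).trans hy1.le) with h | h
    · exact absurd h (not_le.2 hy2)
    · rcases le_max_iff.1 h with h | h
      · linarith
      · exact le_antisymm h hFx
  refine ⟨heq, Filter.empty_mem_iff_bot.1 (mem_nhdsWithin_iff_exists_mem_nhds_inter.2
    ⟨Set.Ioo l u, Ioo_mem_nhds hl hu, ?_⟩)⟩
  rintro y ⟨hylu, hyF, hy1⟩
  have h1 := hslope' y hylu (ne_of_gt hy1)
  rw [Set.mem_ofPred_eq] at hyF
  rw [hyF, heq] at h1
  simp at h1

/-! ### Mass above a level: L² against L¹. -/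

/-- `⟨φ²⟩_J - ⟨φ⟩_J² ≤ ε²` for all intervals `J ⊆ (a, b)`, with denominators cleared. -/
def VarianceLE (φ : ℝ → ℝ) (a b ε : ℝ) : Prop :=
  ∀ c d, a ≤ c → c < d → d ≤ b →
    (d - c) * (∫ x in Set.Ioo c d, φ x ^ 2) - (∫ x in Set.Ioo c d, φ x) ^ 2 ≤ ε ^ 2 * (d - c) ^ 2

lemma integrableOn_posPart_sub {φ : ℝ → ℝ} {a b : ℝ} (h : IntegrableOn φ (Set.Ioo a b)) (t : ℝ) :
    IntegrableOn (fun x => max (φ x - t) 0) (Set.Ioo a b) :=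
  (Integrable.sub h (integrableOn_const (by simp) (by simp))).pos_part

lemma integrableOn_sq_sub {φ : ℝ → ℝ} {a b : ℝ} (h : IntegrableOn φ (Set.Ioo a b))
    (h2 : IntegrableOn (fun x => φ x ^ 2) (Set.Ioo a b)) (t : ℝ) :
    IntegrableOn (fun x => (φ x - t) ^ 2) (Set.Ioo a b) := by
  have : (fun x => (φ x - t) ^ 2) = fun x => φ x ^ 2 - 2 * t * φ x + t ^ 2 := by
    ext x; ring
  rw [this]
  exact (Integrable.sub h2 (Integrable.const_mul h _)).add (integrableOn_const (by simp) (by simp))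

lemma integrableOn_sq_posPart_sub {φ : ℝ → ℝ} {a b : ℝ} (h : IntegrableOn φ (Set.Ioo a b))
    (h2 : IntegrableOn (fun x => φ x ^ 2) (Set.Ioo a b)) (t : ℝ) :
    IntegrableOn (fun x => max (φ x - t) 0 ^ 2) (Set.Ioo a b) := by
  refine Integrable.mono' (integrableOn_sq_sub h h2 t)
    ((integrableOn_posPart_sub h t).aestronglyMeasurable.pow 2) (ae_of_all _ fun x => ?_)
  rw [Real.norm_of_nonneg (sq_nonneg _)]
  rcases max_cases (φ x - t) 0 with ⟨h, _⟩ | ⟨h, _⟩ <;> rw [h]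
  simpa using sq_nonneg (φ x - t)

/-- With mean t + ε, the average of (φ-t)² is the variance plus ε², hence at most 2ε², which is 2ε
times the average of φ-t. -/
lemma setIntegral_sq_sub_sub_nonpos {φ : ℝ → ℝ} {c d ε t : ℝ} (hcd : c < d)
    (hφ : IntegrableOn φ (Set.Ioo c d)) (hφ2 : IntegrableOn (fun x => φ x ^ 2) (Set.Ioo c d))
    (hV : (d - c) * (∫ x in Set.Ioo c d, φ x ^ 2) - (∫ x in Set.Ioo c d, φ x) ^ 2 ≤
      ε ^ 2 * (d - c) ^ 2)
    (hA : ∫ x in Set.Ioo c d, φ x = (t + ε) * (d - c)) :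
    ∫ x in Set.Ioo c d, ((φ x - t) ^ 2 - 2 * ε * (φ x - t)) ≤ 0 := by
  have hexp : (fun x => (φ x - t) ^ 2 - 2 * ε * (φ x - t)) =
      fun x => φ x ^ 2 - 2 * (t + ε) * φ x + (t ^ 2 + 2 * ε * t) := by
    ext x; ring
  have hi : IntegrableOn (fun x => φ x ^ 2 - 2 * (t + ε) * φ x) (Set.Ioo c d) :=
    Integrable.sub hφ2 (Integrable.const_mul hφ _)
  rw [hexp, integral_add hi (integrableOn_const (by simp) (by simp)), integral_sub hφ2 (Integrable.const_mul hφ _),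
    integral_const_mul, hA, setIntegral_const]
  have hvol : volume.real (Set.Ioo c d) = d - c := by simp [hcd.le]
  rw [hvol, smul_eq_mul]
  rw [hA] at hV
  have hl : 0 < d - c := sub_pos.2 hcd
  have : (∫ x in Set.Ioo c d, φ x ^ 2) ≤ (ε ^ 2 + (t + ε) ^ 2) * (d - c) := by
    by_contra! hcon
    nlinarith
  nlinarith

/-- For intervals of mean at most `t + ε`, the `L²` mass above the level `t` is controlled
by the `L¹` mass above it. -/
lemma VarianceLE.integral_sq_posPart_le {φ : ℝ → ℝ} {a b ε t : ℝ} (hab : a < b) (hε : 0 ≤ ε)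
    (hφ : IntegrableOn φ (Set.Ioo a b)) (hφ2 : IntegrableOn (fun x => φ x ^ 2) (Set.Ioo a b))
    (hV : VarianceLE φ a b ε) (hmean : ∫ x in Set.Ioo a b, φ x ≤ (t + ε) * (b - a)) :
    ∫ x in Set.Ioo a b, max (φ x - t) 0 ^ 2 ≤ 2 * ε * ∫ x in Set.Ioo a b, max (φ x - t) 0 := by
  set g : ℝ → ℝ := (Set.Ioo a b).indicator fun x => φ x - (t + ε) with hg
  have hsub : IntegrableOn (fun x => φ x - (t + ε)) (Set.Ioo a b) :=
    Integrable.sub hφ (integrableOn_const (by simp) (by simp))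
  have hgi : Integrable g := (integrable_indicator_iff measurableSet_Ioo).2 hsub
  set F : ℝ → ℝ := fun x => ∫ y in a..x, g y with hFdef
  have hF : Continuous F := intervalIntegral.continuous_primitive (fun _ _ => hgi.intervalIntegrable) a
  have hFsub : ∀ c d, a ≤ c → c ≤ d → d ≤ b →
      F d - F c = (∫ x in Set.Ioo c d, φ x) - (t + ε) * (d - c) := by
    intro c d hac hcd hdb
    have hss : Set.Ioo c d ⊆ Set.Ioo a b := Set.Ioo_subset_Ioo hac hdb
    rw [hFdef]
    simp only
    rw [intervalIntegral.integral_interval_sub_left hgi.intervalIntegrable hgi.intervalIntegrable,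
      intervalIntegral.integral_of_le hcd, integral_Ioc_eq_integral_Ioo, hg,
      setIntegral_indicator measurableSet_Ioo, Set.inter_eq_left.2 hss,
      integral_sub (hφ.mono_set hss) (integrableOn_const (by simp) (by simp)), setIntegral_const]
    simp [hcd, mul_comm]
  have hba : F b ≤ F a := by
    have := hFsub a b le_rfl hab.le le_rfl
    linarith
  set N := contactSet F a b with hN
  have hNc : IsClosed N := isClosed_contactSet hF a b
  have hfi : IntegrableOn (fun x => max (φ x - t) 0 ^ 2 - 2 * ε * max (φ x - t) 0)
      (Set.Ioo a b) :=
    Integrable.sub (integrableOn_sq_posPart_sub hφ hφ2 t)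
      (Integrable.const_mul (integrableOn_posPart_sub hφ t) _)
  have hGi : IntegrableOn (fun x => (φ x - t) ^ 2 - 2 * ε * (φ x - t)) (Set.Ioo a b) :=
    Integrable.sub (integrableOn_sq_sub hφ hφ2 t) (Integrable.const_mul
      (Integrable.sub hφ (integrableOn_const (by simp) (by simp))) _)
  suffices hmain : ∫ x in Set.Ioo a b, (max (φ x - t) 0 ^ 2 - 2 * ε * max (φ x - t) 0) ≤ 0 by
    rw [integral_sub (integrableOn_sq_posPart_sub hφ hφ2 t)
      (Integrable.const_mul (integrableOn_posPart_sub hφ t) _), integral_const_mul] at hmain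
    linarith
  rw [← integral_inter_add_sdiff hNc.measurableSet hfi]
  -- Almost everywhere on N, F' = φ-(t+ε) ≤ 0, so u = (φ-t)₊ lies in [0, ε] and u² ≤ 2εu.
  have h1 : ∫ x in Set.Ioo a b ∩ N, (max (φ x - t) 0 ^ 2 - 2 * ε * max (φ x - t) 0) ≤ 0 := by
    refine setIntegral_nonpos_ae (measurableSet_Ioo.inter hNc.measurableSet) ?_
    have hcount := (countable_contactSet_deriv_pos F a b).ae_notMem volume
    filter_upwards [LocallyIntegrable.ae_hasDerivAt_integral hgi.locallyIntegrable, hcount] with x hx hxc hxN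
    have hle : φ x ≤ t + ε := by
      by_contra! hcon
      refine hxc ⟨hxN.2, hxN.1.2, hxN.1.1, g x, ?_, hx a⟩
      rw [hg, Set.indicator_of_mem hxN.1]
      linarith
    have h0 : 0 ≤ max (φ x - t) 0 := le_max_right _ _
    have h1 : max (φ x - t) 0 ≤ ε := max_le (by linarith) hε
    nlinarith
  -- Off N the positive parts can be dropped, since u²-2εu ≥ 0 for u < 0. On each component F takes
  -- equal values at the two ends, so φ has mean t + ε there.
  have h2 : ∫ x in Set.Ioo a b \ N, (max (φ x - t) 0 ^ 2 - 2 * ε * max (φ x - t) 0) ≤ 0 := by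
    refine (setIntegral_mono (hfi.mono_set Set.sdiff_subset) (hGi.mono_set Set.sdiff_subset)
      fun x => ?_).trans
      (setIntegral_nonpos_of_components (isOpen_Ioo.sdiff hNc)
        ((Metric.isBounded_Ioo a b).subset Set.sdiff_subset) (hGi.mono_set Set.sdiff_subset) ?_)
    · simp only
      rcases max_cases (φ x - t) 0 with ⟨h, _⟩ | ⟨h, h'⟩ <;> rw [h]
      nlinarith [sq_nonneg (φ x - t)]
    · intro c d hcd hcdU hc hd
      have hcl : Set.Icc c d ⊆ Set.Icc a b := by
        rw [← closure_Ioo hcd.ne, ← closure_Ioo hab.ne]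
        exact closure_mono (hcdU.trans Set.sdiff_subset)
      have hca := hcl (Set.left_mem_Icc.2 hcd.le)
      have hda := hcl (Set.right_mem_Icc.2 hcd.le)
      have hmemN : ∀ z ∈ Set.Icc a b, z ∉ Set.Ioo a b \ N → z ∈ N := by
        intro z hz hzU
        rcases hz.1.eq_or_lt with h | h
        · exact h ▸ left_mem_contactSet hab.le hba
        rcases hz.2.eq_or_lt with h' | h'
        · exact h' ▸ right_mem_contactSet hab.le
        by_contra hcon
        exact hzU ⟨⟨h, h'⟩, hcon⟩
      have hFcd : F c = F d := eq_of_contactSet_gap hF hcd (hmemN c hca hc) (hmemN d hda hd)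
        fun x hx => (hcdU hx).2
      have hss : Set.Ioo c d ⊆ Set.Ioo a b := hcdU.trans Set.sdiff_subset
      refine setIntegral_sq_sub_sub_nonpos hcd (hφ.mono_set hss) (hφ2.mono_set hss)
        (hV c d hca.1 hcd hda.2) ?_
      have := hFsub c d hca.1 hcd.le hda.2
      linarith
  linarith

/-! ### Exponential decay of the truncated second moment. -/

lemma VarianceLE.neg {φ : ℝ → ℝ} {a b ε : ℝ} (hV : VarianceLE φ a b ε) :
    VarianceLE (fun x => -φ x) a b ε := by
  intro c d hc hcd hd
  have := hV c d hc hcd hd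
  simpa [integral_neg] using this

/-- At a level t ≥ 0, at most one of y and -y exceeds t, so the two tails add without interaction.
-/
lemma posPart_abs_sub {y t : ℝ} (ht : 0 ≤ t) :
    max (|y| - t) 0 = max (y - t) 0 + max (-y - t) 0 := by
  rcases abs_cases y with ⟨h, h'⟩ | ⟨h, h'⟩ <;> rw [h]
  · rw [max_eq_right (a := -y - t) (by linarith), add_zero]
  · rw [max_eq_right (a := y - t) (by linarith), zero_add]

lemma sq_posPart_abs_sub {y t : ℝ} (ht : 0 ≤ t) :
    max (|y| - t) 0 ^ 2 = max (y - t) 0 ^ 2 + max (-y - t) 0 ^ 2 := by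
  rcases abs_cases y with ⟨h, h'⟩ | ⟨h, h'⟩ <;> rw [h]
  · rw [max_eq_right (a := -y - t) (by linarith)]; ring
  · rw [max_eq_right (a := y - t) (by linarith)]; ring

/-- The convex function u ↦ (y-u)₊² lies above its tangent at s; this is that inequality at t. -/
lemma posPart_sub_sq_sub_le {y t s : ℝ} (hts : t ≤ s) :
    2 * (s - t) * max (y - s) 0 ≤ max (y - t) 0 ^ 2 - max (y - s) 0 ^ 2 := by
  rcases le_total y s with h | h
  · rw [max_eq_right (a := y - s) (by linarith)]
    nlinarith [sq_nonneg (max (y - t) 0)]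
  · rw [max_eq_left (a := y - s) (by linarith), max_eq_left (a := y - t) (by linarith)]
    nlinarith [sq_nonneg (s - t)]

section
variable {φ : ℝ → ℝ} {a b ε t : ℝ}

lemma integrableOn_sq_abs (hφ2 : IntegrableOn (fun x => φ x ^ 2) (Set.Ioo a b)) :
    IntegrableOn (fun x => |φ x| ^ 2) (Set.Ioo a b) := by
  simpa only [sq_abs] using hφ2

/-- Mean zero is at most t + ε for both φ and -φ, so the one-sided estimate applies to each tail. -/
lemma VarianceLE.integral_sq_posPart_abs_le (hab : a < b) (hε : 0 ≤ ε)
    (hφ : IntegrableOn φ (Set.Ioo a b)) (hφ2 : IntegrableOn (fun x => φ x ^ 2) (Set.Ioo a b))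
    (hV : VarianceLE φ a b ε) (hmean : ∫ x in Set.Ioo a b, φ x = 0) (ht : 0 ≤ t) :
    ∫ x in Set.Ioo a b, max (|φ x| - t) 0 ^ 2 ≤
      2 * ε * ∫ x in Set.Ioo a b, max (|φ x| - t) 0 := by
  have hφ' : IntegrableOn (fun x => -φ x) (Set.Ioo a b) := hφ.neg
  have hφ2' : IntegrableOn (fun x => (-φ x) ^ 2) (Set.Ioo a b) := by simpa using hφ2
  have hm : 0 ≤ (t + ε) * (b - a) := mul_nonneg (by linarith) (by linarith)
  have h1 := hV.integral_sq_posPart_le hab hε hφ hφ2 (hmean.trans_le hm)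
  have h2 := hV.neg.integral_sq_posPart_le hab hε hφ' hφ2'
    (by rw [integral_neg, hmean, neg_zero]; exact hm)
  simp_rw [sq_posPart_abs_sub ht, posPart_abs_sub ht]
  rw [integral_add (integrableOn_sq_posPart_sub hφ hφ2 t) (integrableOn_sq_posPart_sub hφ' hφ2' t),
    integral_add (integrableOn_posPart_sub hφ t) (integrableOn_posPart_sub hφ' t)]
  linarith

/-- A finite-difference form of G' ≤ -G/ε, which avoids differentiating under the integral. -/
lemma VarianceLE.integral_sq_posPart_abs_step (hab : a < b) (hε : 0 < ε)
    (hφ : IntegrableOn φ (Set.Ioo a b)) (hφ2 : IntegrableOn (fun x => φ x ^ 2) (Set.Ioo a b))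
    (hV : VarianceLE φ a b ε) (hmean : ∫ x in Set.Ioo a b, φ x = 0) {s : ℝ} (ht : 0 ≤ t)
    (hts : t ≤ s) :
    (∫ x in Set.Ioo a b, max (|φ x| - s) 0 ^ 2) * (1 + (s - t) / ε) ≤
      ∫ x in Set.Ioo a b, max (|φ x| - t) 0 ^ 2 := by
  have h1 := hV.integral_sq_posPart_abs_le hab hε.le hφ hφ2 hmean (ht.trans hts)
  have hi := fun r => integrableOn_sq_posPart_sub hφ.abs (integrableOn_sq_abs hφ2) r
  have h2 : 2 * (s - t) * (∫ x in Set.Ioo a b, max (|φ x| - s) 0) ≤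
      (∫ x in Set.Ioo a b, max (|φ x| - t) 0 ^ 2) - ∫ x in Set.Ioo a b, max (|φ x| - s) 0 ^ 2 := by
    rw [← integral_const_mul, ← integral_sub (hi t) (hi s)]
    exact integral_mono (Integrable.const_mul (integrableOn_posPart_sub hφ.abs s) _)
      ((hi t).sub (hi s)) fun x => posPart_sub_sq_sub_le hts
  have h3 : (∫ x in Set.Ioo a b, max (|φ x| - s) 0 ^ 2) * ((s - t) / ε) ≤
      2 * (s - t) * (∫ x in Set.Ioo a b, max (|φ x| - s) 0) := by
    rw [mul_div_assoc', div_le_iff₀ hε]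
    nlinarith [mul_le_mul_of_nonneg_left h1 (sub_nonneg.2 hts)]
  linarith

/-- Exponential decay of the `L²` mass of a mean-zero function above the level `t`. -/
lemma VarianceLE.integral_sq_posPart_abs_le_exp (hab : a < b) (hε : 0 < ε)
    (hφ : IntegrableOn φ (Set.Ioo a b)) (hφ2 : IntegrableOn (fun x => φ x ^ 2) (Set.Ioo a b))
    (hV : VarianceLE φ a b ε) (hmean : ∫ x in Set.Ioo a b, φ x = 0) (ht : 0 ≤ t) :
    ∫ x in Set.Ioo a b, max (|φ x| - t) 0 ^ 2 ≤
      Real.exp (-(t / ε)) * ∫ x in Set.Ioo a b, φ x ^ 2 := by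
  set G : ℝ → ℝ := fun r => ∫ x in Set.Ioo a b, max (|φ x| - r) 0 ^ 2 with hG
  have hG0 : G 0 = ∫ x in Set.Ioo a b, φ x ^ 2 := by
    simp [hG]
  have hiter : ∀ δ, 0 ≤ δ → ∀ n : ℕ, G (n * δ) * (1 + δ / ε) ^ n ≤ G 0 := by
    intro δ hδ n
    induction n with
    | zero => simp
    | succ n ih =>
      have h := hV.integral_sq_posPart_abs_step hab hε hφ hφ2 hmean (t := n * δ)
        (s := (n + 1 : ℕ) * δ) (by positivity) (by push_cast; linarith)
      have e : ((n + 1 : ℕ) * δ - n * δ) = δ := by push_cast; ring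
      rw [e] at h
      calc G ((n + 1 : ℕ) * δ) * (1 + δ / ε) ^ (n + 1)
          = G ((n + 1 : ℕ) * δ) * (1 + δ / ε) * (1 + δ / ε) ^ n := by ring
        _ ≤ G (n * δ) * (1 + δ / ε) ^ n := by gcongr
        _ ≤ G 0 := ih
  -- With n steps of length t/n the accumulated factor (1 + t/(εn))^n tends to e^{t/ε}.
  have hlim : Filter.Tendsto (fun n : ℕ => G t * (1 + t / ε / n) ^ n) Filter.atTop
      (nhds (G t * Real.exp (t / ε))) :=
    (Real.tendsto_one_add_div_pow_exp (t / ε)).const_mul _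
  have hle : G t * Real.exp (t / ε) ≤ G 0 := by
    refine le_of_tendsto hlim ?_
    filter_upwards [Filter.eventually_gt_atTop 0] with n hn
    have h := hiter (t / n) (by positivity) n
    have hn' : (n : ℝ) ≠ 0 := by positivity
    rwa [mul_div_cancel₀ _ hn', div_right_comm] at h
  rw [← hG0, Real.exp_neg, inv_mul_eq_div, le_div_iff₀ (Real.exp_pos _)]
  exact hle

end

/-! ### Powers as mixtures of homogeneous kernels. -/

lemma setLIntegral_Ioi_comp_mul_left (f : ℝ → ENNReal) {r : ℝ} (hr : 0 < r) :
    ∫⁻ t in Set.Ioi 0, f t = ENNReal.ofReal r * ∫⁻ t in Set.Ioi 0, f (r * t) := by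
  have himg : (fun t => r * t) '' Set.Ioi 0 = Set.Ioi 0 := by
    rw [Set.image_mul_left_Ioi hr, mul_zero]
  have h := lintegral_image_eq_lintegral_abs_deriv_mul (s := Set.Ioi (0 : ℝ)) measurableSet_Ioi
    (f := fun t => r * t) (f' := fun _ => r)
    (fun x _ => by simpa using ((hasDerivAt_id x).const_mul r).hasDerivWithinAt)
    (fun x _ y _ hxy => mul_left_cancel₀ hr.ne' hxy) f
  rw [himg] at h
  rw [h, abs_of_pos hr, lintegral_const_mul' _ _ ENNReal.ofReal_ne_top]

section
variable {K : ℝ → ℝ → ℝ} {p : ℝ}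

/-- The integral of a kernel, homogeneous of degree two, against `t ^ (p - 3)` is a multiple of
the `p`-th power. -/
lemma lintegral_rpow_mul_kernel (hp : 0 < p) (hK0 : ∀ t, 0 < t → K 0 t = 0)
    (hKhom : ∀ r y t, 0 < r → K (r * y) (r * t) = r ^ 2 * K y t) {y : ℝ} (hy : 0 ≤ y) :
    ∫⁻ t in Set.Ioi 0, ENNReal.ofReal (t ^ (p - 3)) * ENNReal.ofReal (K y t) =
      ENNReal.ofReal (y ^ p) *
        ∫⁻ t in Set.Ioi 0, ENNReal.ofReal (t ^ (p - 3)) * ENNReal.ofReal (K 1 t) := by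
  rcases hy.eq_or_lt with rfl | hy
  · rw [Real.zero_rpow hp.ne', ENNReal.ofReal_zero, zero_mul,
      setLIntegral_congr_fun (g := fun _ => 0) measurableSet_Ioi, lintegral_zero]
    intro t ht
    simp [hK0 t ht]
  · have hpow : y ^ p = y * (y ^ (p - 3) * y ^ 2) := by
      rw [← Real.rpow_natCast y 2, ← Real.rpow_add hy, ← Real.rpow_one_add' hy.le]
      · congr 1; push_cast; ring
      · push_cast; linarith
    rw [setLIntegral_Ioi_comp_mul_left _ hy, hpow, ENNReal.ofReal_mul hy.le, mul_assoc]
    congr 1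
    rw [← lintegral_const_mul' _ _ ENNReal.ofReal_ne_top]
    refine setLIntegral_congr_fun measurableSet_Ioi fun t (ht : 0 < t) => ?_
    have h1 := hKhom y 1 t hy
    rw [mul_one] at h1
    rw [h1, Real.mul_rpow hy.le ht.le, ENNReal.ofReal_mul (by positivity),
      ENNReal.ofReal_mul (by positivity), ENNReal.ofReal_mul (by positivity)]
    ring

/-- Tonelli applied to the kernel representation. Working in `ENNReal` requires no finiteness of the
p-th moment beforehand. -/
lemma lintegral_rpow_mul_eq_lintegral_kernel {Ω : Type*} [MeasurableSpace Ω] {μ : Measure Ω}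
    [SFinite μ] {Y : Ω → ℝ} (hY : AEMeasurable Y μ) (hY0 : ∀ᵐ x ∂μ, 0 ≤ Y x) (hp : 0 < p)
    (hKm : Measurable (Function.uncurry K)) (hK0 : ∀ t, 0 < t → K 0 t = 0)
    (hKhom : ∀ r y t, 0 < r → K (r * y) (r * t) = r ^ 2 * K y t) :
    (∫⁻ x, ENNReal.ofReal (Y x ^ p) ∂μ) *
        ∫⁻ t in Set.Ioi 0, ENNReal.ofReal (t ^ (p - 3)) * ENNReal.ofReal (K 1 t) =
      ∫⁻ t in Set.Ioi 0, ENNReal.ofReal (t ^ (p - 3)) * ∫⁻ x, ENNReal.ofReal (K (Y x) t) ∂μ := by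
  have hKY : AEMeasurable (fun z : Ω × ℝ => ENNReal.ofReal (K (Y z.1) z.2))
      (μ.prod (volume.restrict (Set.Ioi 0))) :=
    ENNReal.measurable_ofReal.comp_aemeasurable (hKm.comp_aemeasurable
      ((hY.comp_quasiMeasurePreserving Measure.quasiMeasurePreserving_fst).prodMk
        measurable_snd.aemeasurable))
  have hKYt : ∀ t, AEMeasurable (fun x => ENNReal.ofReal (K (Y x) t)) μ := fun t =>
    ENNReal.measurable_ofReal.comp_aemeasurable (hKm.comp_aemeasurable
      (hY.prodMk aemeasurable_const))
  have hYp : AEMeasurable (fun x => ENNReal.ofReal (Y x ^ p)) μ :=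
    ENNReal.measurable_ofReal.comp_aemeasurable (hY.pow_const p)
  rw [← lintegral_mul_const'' _ hYp]
  calc _ = ∫⁻ x, (∫⁻ t in Set.Ioi 0,
        ENNReal.ofReal (t ^ (p - 3)) * ENNReal.ofReal (K (Y x) t)) ∂μ := by
        refine lintegral_congr_ae ?_
        filter_upwards [hY0] with x hx
        rw [lintegral_rpow_mul_kernel hp hK0 hKhom hx]
    _ = ∫⁻ t in Set.Ioi 0, ∫⁻ x,
        ENNReal.ofReal (t ^ (p - 3)) * ENNReal.ofReal (K (Y x) t) ∂μ := by
        refine lintegral_lintegral_swap ?_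
        exact ((ENNReal.measurable_ofReal.comp
          (measurable_snd.pow_const (p - 3))).aemeasurable).mul hKY
    _ = _ := by
        refine lintegral_congr fun t => ?_
        rw [lintegral_const_mul'' _ (hKYt t)]

lemma lintegral_exp_neg_mul_rpow {p : ℝ} (hp : 0 < p) :
    ∫⁻ y in Set.Ioi 0, ENNReal.ofReal (Real.exp (-y)) * ENNReal.ofReal (y ^ p) =
      ENNReal.ofReal (Real.Gamma (p + 1)) := by
  have hi := Real.GammaIntegral_convergent (s := p + 1) (by linarith)
  rw [Real.Gamma_eq_integral (by linarith), ofReal_integral_eq_lintegral_ofReal hi]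
  · refine setLIntegral_congr_fun measurableSet_Ioi fun y (hy : 0 < y) => ?_
    simp [ENNReal.ofReal_mul (Real.exp_pos (-y)).le]
  · filter_upwards [ae_restrict_mem measurableSet_Ioi] with y (hy : 0 < y)
    positivity

/-- The same identity for the standard exponential law, whose p-th moment is Γ(p+1). The normalising
integral then cancels in comparisons and is never evaluated. -/
lemma Gamma_mul_lintegral_kernel (hp : 0 < p)
    (hKm : Measurable (Function.uncurry K)) (hK0 : ∀ t, 0 < t → K 0 t = 0)
    (hKhom : ∀ r y t, 0 < r → K (r * y) (r * t) = r ^ 2 * K y t) :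
    ENNReal.ofReal (Real.Gamma (p + 1)) *
        ∫⁻ t in Set.Ioi 0, ENNReal.ofReal (t ^ (p - 3)) * ENNReal.ofReal (K 1 t) =
      ∫⁻ t in Set.Ioi 0, ENNReal.ofReal (t ^ (p - 3)) *
        ∫⁻ y in Set.Ioi 0, ENNReal.ofReal (Real.exp (-y)) * ENNReal.ofReal (K y t) := by
  have hE : Measurable fun y : ℝ => ENNReal.ofReal (Real.exp (-y)) := by fun_prop
  have h := lintegral_rpow_mul_eq_lintegral_kernel (K := K)
    (μ := (volume.restrict (Set.Ioi (0 : ℝ))).withDensity fun y => ENNReal.ofReal (Real.exp (-y)))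
    (Y := id) aemeasurable_id
    ((withDensity_absolutelyContinuous _ _).ae_le
      ((ae_restrict_mem measurableSet_Ioi).mono fun y (hy : 0 < y) => hy.le)) hp hKm hK0 hKhom
  simp only [id] at h
  rw [lintegral_withDensity_eq_lintegral_mul _ hE (by fun_prop)] at h
  simp only [Pi.mul_apply] at h
  rw [lintegral_exp_neg_mul_rpow hp] at h
  rw [h]
  refine lintegral_congr fun t => ?_
  have hKt : Measurable fun y => ENNReal.ofReal (K y t) :=
    ENNReal.measurable_ofReal.comp (hKm.comp (measurable_id.prodMk measurable_const))
  rw [lintegral_withDensity_eq_lintegral_mul _ hE hKt]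
  rfl

lemma lintegral_rpow_mul_comp_div {h : ℝ → ENNReal} {ε : ℝ} (hε : 0 < ε) :
    ∫⁻ t in Set.Ioi 0, ENNReal.ofReal (t ^ (p - 3)) * h (t / ε) =
      ENNReal.ofReal (ε ^ (p - 2)) * ∫⁻ t in Set.Ioi 0, ENNReal.ofReal (t ^ (p - 3)) * h t := by
  rw [setLIntegral_Ioi_comp_mul_left _ hε, show p - 2 = 1 + (p - 3) by ring, Real.rpow_add hε,
    Real.rpow_one, ENNReal.ofReal_mul hε.le, mul_assoc]
  congr 1
  rw [← lintegral_const_mul' _ _ ENNReal.ofReal_ne_top]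
  refine setLIntegral_congr_fun measurableSet_Ioi fun t (ht : 0 < t) => ?_
  rw [Real.mul_rpow hε.le ht.le, mul_div_cancel_left₀ _ hε.ne', ENNReal.ofReal_mul (by positivity),
    mul_assoc]

end

/-! ### The exponential law, and finiteness of the kernel integrals. -/

/-- By lack of memory the value is e^{-t} times the second moment 2; this is the extremal decay. -/
lemma integral_exp_neg_mul_sq_posPart {t : ℝ} (ht : 0 ≤ t) :
    IntegrableOn (fun y => Real.exp (-y) * max (y - t) 0 ^ 2) (Set.Ioi 0) ∧
      ∫ y in Set.Ioi 0, Real.exp (-y) * max (y - t) 0 ^ 2 = 2 * Real.exp (-t) := by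
  have heq : (fun y => Real.exp (-y) * max (y - t) 0 ^ 2) =
      (Set.Ioi t).indicator fun y => Real.exp (-y) * (y - t) ^ 2 := by
    ext y
    by_cases hy : t < y
    · rw [Set.indicator_of_mem (by exact hy), max_eq_left (by linarith)]
    · rw [Set.indicator_of_notMem (by exact hy), max_eq_right (by linarith)]
      simp
  have hinter : Set.Ioi 0 ∩ Set.Ioi t = Set.Ioi t :=
    Set.inter_eq_right.2 (Set.Ioi_subset_Ioi ht)
  have hderiv : ∀ y ∈ Set.Ici t, HasDerivAt
      (fun y => -(((y - t) ^ 2 + 2 * (y - t) + 2) * Real.exp (-y)))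
      (Real.exp (-y) * (y - t) ^ 2) y := by
    intro y _
    have h1 : HasDerivAt (fun y : ℝ => y - t) 1 y := (hasDerivAt_id y).sub_const t
    have h2 : HasDerivAt (fun y : ℝ => Real.exp (-y)) (Real.exp (-y) * -1) y :=
      (hasDerivAt_neg y).exp
    convert! ((((h1.pow 2).add (h1.const_mul 2)).add_const 2).mul h2).neg using 1
    simp
    ring
  have hnn : ∀ y ∈ Set.Ioi t, 0 ≤ Real.exp (-y) * (y - t) ^ 2 := fun y _ => by positivity
  have hlim : Filter.Tendsto (fun y => -(((y - t) ^ 2 + 2 * (y - t) + 2) * Real.exp (-y)))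
      Filter.atTop (nhds 0) := by
    have hn := fun n => (Real.tendsto_pow_mul_exp_neg_atTop_nhds_zero n).comp
      (Filter.tendsto_atTop_add_const_right Filter.atTop (-t) Filter.tendsto_id)
    have := ((((hn 2).add ((hn 1).const_mul 2)).add ((hn 0).const_mul 2)).mul_const
      (Real.exp (-t))).neg
    simp only [mul_zero, add_zero, zero_mul, neg_zero] at this
    refine this.congr fun y => ?_
    have he : Real.exp (-y) = Real.exp (-(y - t)) * Real.exp (-t) := by
      rw [← Real.exp_add]; congr 1; ring
    rw [he]
    simp only [Function.comp, id, ← sub_eq_add_neg]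
    ring
  rw [heq]
  constructor
  · rw [IntegrableOn, integrable_indicator_iff measurableSet_Ioi, IntegrableOn,
      Measure.restrict_restrict measurableSet_Ioi, Set.inter_comm, hinter]
    exact integrableOn_Ioi_deriv_of_nonneg' hderiv hnn hlim
  · rw [setIntegral_indicator measurableSet_Ioi, hinter,
      integral_Ioi_of_hasDerivAt_of_nonneg' hderiv hnn hlim]
    simp

lemma lintegral_exp_neg_mul_sq_posPart {t : ℝ} (ht : 0 ≤ t) :
    ∫⁻ y in Set.Ioi 0, ENNReal.ofReal (Real.exp (-y)) * ENNReal.ofReal (max (y - t) 0 ^ 2) =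
      ENNReal.ofReal (2 * Real.exp (-t)) := by
  obtain ⟨hi, he⟩ := integral_exp_neg_mul_sq_posPart ht
  rw [← he, ofReal_integral_eq_lintegral_ofReal hi (ae_of_all _ fun y => by positivity)]
  simp_rw [ENNReal.ofReal_mul (Real.exp_pos _).le]

lemma lintegral_exp_neg_mul_sq_sub_sq_posPart {t : ℝ} (ht : 0 ≤ t) :
    ∫⁻ y in Set.Ioi 0, ENNReal.ofReal (Real.exp (-y)) *
      ENNReal.ofReal (y ^ 2 - max (y - t) 0 ^ 2) = ENNReal.ofReal (2 * (1 - Real.exp (-t))) := by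
  obtain ⟨hi, he⟩ := integral_exp_neg_mul_sq_posPart ht
  obtain ⟨hi0, he0⟩ := integral_exp_neg_mul_sq_posPart (t := 0) le_rfl
  have he1 : 2 * (1 - Real.exp (-t)) = ∫ y in Set.Ioi 0,
      (Real.exp (-y) * max (y - 0) 0 ^ 2 - Real.exp (-y) * max (y - t) 0 ^ 2) := by
    rw [integral_sub hi0 hi, he, he0, neg_zero, Real.exp_zero]; ring
  have hi1 : IntegrableOn (fun y => Real.exp (-y) * max (y - 0) 0 ^ 2 -
      Real.exp (-y) * max (y - t) 0 ^ 2) (Set.Ioi 0) := hi0.sub hi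
  rw [he1, ofReal_integral_eq_lintegral_ofReal hi1]
  · refine setLIntegral_congr_fun measurableSet_Ioi fun y (hy : 0 < y) => ?_
    rw [← ENNReal.ofReal_mul (Real.exp_pos _).le, sub_zero, max_eq_left hy.le, mul_sub]
  · refine ae_of_all _ fun y => ?_
    change 0 ≤ Real.exp (-y) * _ - Real.exp (-y) * _
    rw [← mul_sub]
    refine mul_nonneg (Real.exp_pos _).le (sub_nonneg.2 ?_)
    gcongr

lemma lintegral_kernel_pos {K : ℝ → ℝ → ℝ} {p : ℝ} (hKm : Measurable (Function.uncurry K))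
    (hKpos : ∀ t, 0 < t → t < 1 → 0 < K 1 t) :
    ∫⁻ t in Set.Ioi 0, ENNReal.ofReal (t ^ (p - 3)) * ENNReal.ofReal (K 1 t) ≠ 0 := by
  have hm : Measurable fun t : ℝ => ENNReal.ofReal (t ^ (p - 3)) * ENNReal.ofReal (K 1 t) :=
    (ENNReal.measurable_ofReal.comp (measurable_id.pow_const (p - 3))).mul
      (ENNReal.measurable_ofReal.comp (hKm.comp (measurable_const.prodMk measurable_id)))
  refine (lt_of_lt_of_le ?_ (lintegral_mono_set (show Set.Ioo (0 : ℝ) 1 ⊆ Set.Ioi 0 from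
    Set.Ioo_subset_Ioi_self))).ne'
  rw [setLIntegral_pos_iff hm]
  refine lt_of_lt_of_le ?_ (measure_mono (s := Set.Ioo (0 : ℝ) 1) fun t ht => ⟨?_, ht⟩)
  · simp
  · have h1 : 0 < t ^ (p - 3) := Real.rpow_pos_of_pos ht.1 _
    have h2 := hKpos t ht.1 ht.2
    simp [Function.mem_support, h1, h2]

lemma lintegral_sq_posPart_kernel_ne_top {p : ℝ} (hp : 2 < p) :
    ∫⁻ t in Set.Ioi 0, ENNReal.ofReal (t ^ (p - 3)) * ENNReal.ofReal (max (1 - t) 0 ^ 2) ≠ ⊤ := by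
  have hi : IntegrableOn (fun t : ℝ => t ^ (p - 3)) (Set.Ioc 0 1) :=
    (intervalIntegral.intervalIntegrable_rpow' (a := 0) (b := 1)
      (by linarith : -1 < p - 3)).1
  have hi' : Integrable ((Set.Ioc 0 1).indicator fun t : ℝ => t ^ (p - 3)) :=
    (integrable_indicator_iff measurableSet_Ioc).2 hi
  refine (lt_of_le_of_lt ?_ (hi'.integrableOn (s := Set.Ioi 0)).lintegral_lt_top).ne
  refine setLIntegral_mono' measurableSet_Ioi fun t (ht : 0 < t) => ?_
  rw [← ENNReal.ofReal_mul (by positivity)]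
  refine ENNReal.ofReal_le_ofReal ?_
  by_cases h : t ≤ 1
  · rw [Set.indicator_of_mem (by exact ⟨ht, h⟩), max_eq_left (by linarith)]
    refine mul_le_of_le_one_right (by positivity) ?_
    nlinarith
  · rw [Set.indicator_of_notMem (fun h' => h h'.2), max_eq_right (by linarith)]
    simp

/-- The kernel is 2t-t² on (0, 1], so p > 1 gives convergence at 0; it is 1 beyond, so p < 2 gives
convergence at infinity. -/
lemma lintegral_sq_sub_sq_posPart_kernel_ne_top {p : ℝ} (hp : 1 < p) (hp' : p < 2) :
    ∫⁻ t in Set.Ioi 0, ENNReal.ofReal (t ^ (p - 3)) *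
      ENNReal.ofReal (1 ^ 2 - max (1 - t) 0 ^ 2) ≠ ⊤ := by
  have hi1 : IntegrableOn (fun t : ℝ => 2 * t ^ (p - 2)) (Set.Ioc 0 1) :=
    ((intervalIntegral.intervalIntegrable_rpow' (a := 0) (b := 1)
      (by linarith : -1 < p - 2)).1).const_mul 2
  have hi2 : IntegrableOn (fun t : ℝ => t ^ (p - 3)) (Set.Ioi 1) :=
    integrableOn_Ioi_rpow_of_lt (by linarith) one_pos
  have hi1' := (integrable_indicator_iff measurableSet_Ioc).2 hi1
  have hi2' := (integrable_indicator_iff measurableSet_Ioi).2 hi2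
  refine (lt_of_le_of_lt ?_ ((hi1'.add hi2').integrableOn (s := Set.Ioi 0)).lintegral_lt_top).ne
  refine setLIntegral_mono' measurableSet_Ioi fun t (ht : 0 < t) => ?_
  rw [← ENNReal.ofReal_mul (by positivity)]
  refine ENNReal.ofReal_le_ofReal ?_
  rw [Pi.add_apply]
  by_cases h : t ≤ 1
  · rw [Set.indicator_of_mem (by exact ⟨ht, h⟩), Set.indicator_of_notMem (by simpa using h),
      max_eq_left (by linarith), add_zero, show p - 2 = (p - 3) + 1 by ring,
      Real.rpow_add_one ht.ne']
    have : 0 < t ^ (p - 3) := by positivity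
    nlinarith [mul_pos this (mul_pos ht ht)]
  · rw [Set.indicator_of_notMem (fun h' => h h'.2), Set.indicator_of_mem (by simpa using h),
      max_eq_right (by linarith)]
    simp

/-! ### Sharp comparison of p-th moments with the second moment. -/

section
variable {φ : ℝ → ℝ} {a b ε p : ℝ}

lemma lintegral_rpow_abs_le (hp : 2 < p) (hab : a < b) (hε : 0 < ε)
    (hφ : IntegrableOn φ (Set.Ioo a b)) (hφ2 : IntegrableOn (fun x => φ x ^ 2) (Set.Ioo a b))
    (hV : VarianceLE φ a b ε) (hmean : ∫ x in Set.Ioo a b, φ x = 0) :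
    ∫⁻ x in Set.Ioo a b, ENNReal.ofReal (|φ x| ^ p) ≤
      ENNReal.ofReal (Real.Gamma (p + 1) / 2 * ε ^ (p - 2) * ∫ x in Set.Ioo a b, φ x ^ 2) := by
  set K : ℝ → ℝ → ℝ := fun y t => max (y - t) 0 ^ 2 with hK
  have hKm : Measurable (Function.uncurry K) := by
    simp only [hK, Function.uncurry_def]; fun_prop
  have hK0 : ∀ t, 0 < t → K 0 t = 0 := fun t ht => by
    simp only [hK]; rw [max_eq_right (by linarith)]; simp
  have hKhom : ∀ r y t, 0 < r → K (r * y) (r * t) = r ^ 2 * K y t := fun r y t hr => by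
    simp only [hK]
    rw [← mul_pow, mul_max_of_nonneg _ _ hr.le]
    ring_nf
  have hp0 : 0 < p := by linarith
  set κ := ∫⁻ t in Set.Ioi 0, ENNReal.ofReal (t ^ (p - 3)) * ENNReal.ofReal (K 1 t) with hκ
  have hκ0 : κ ≠ 0 := lintegral_kernel_pos hKm fun t _ h1 => by
    have : 0 < 1 - t := by linarith
    simp only [hK]
    positivity
  have hκt : κ ≠ ⊤ := lintegral_sq_posPart_kernel_ne_top hp
  have h1 := Gamma_mul_lintegral_kernel hp0 hKm hK0 hKhom
  obtain ⟨D, hD⟩ : ∃ D : ℝ → ENNReal, ∀ s, D s =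
      ∫⁻ y in Set.Ioi 0, ENNReal.ofReal (Real.exp (-y)) * ENNReal.ofReal (K y s) :=
    ⟨_, fun _ => rfl⟩
  simp_rw [← hD] at h1
  have h2 := lintegral_rpow_mul_eq_lintegral_kernel (μ := volume.restrict (Set.Ioo a b))
    (Y := fun x => |φ x|) hφ.abs.aemeasurable (ae_of_all _ fun x => abs_nonneg _) hp0 hKm hK0 hKhom
  set G := ∫ x in Set.Ioo a b, φ x ^ 2 with hG
  have hG0 : 0 ≤ G := integral_nonneg fun x => sq_nonneg _
  -- The decay bound says that the truncated second moment of |φ| at level t is at most G/2 times `D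
  -- (t / ε)`, the corresponding quantity for the exponential law.
  have h3 : ∫⁻ t in Set.Ioi 0, ENNReal.ofReal (t ^ (p - 3)) *
      (∫⁻ x in Set.Ioo a b, ENNReal.ofReal (K |φ x| t)) ≤
      ENNReal.ofReal (G / 2) * ∫⁻ t in Set.Ioi 0, ENNReal.ofReal (t ^ (p - 3)) * D (t / ε) := by
    rw [← lintegral_const_mul' _ _ ENNReal.ofReal_ne_top]
    refine setLIntegral_mono' measurableSet_Ioi fun t (ht : 0 < t) => ?_
    rw [mul_left_comm]
    gcongr
    rw [← ofReal_integral_eq_lintegral_ofReal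
      (integrableOn_sq_posPart_sub hφ.abs (integrableOn_sq_abs hφ2) t)
      (ae_of_all _ fun x => sq_nonneg _)]
    simp only [hD, hK]
    rw [lintegral_exp_neg_mul_sq_posPart (by positivity), ← ENNReal.ofReal_mul (by positivity)]
    refine ENNReal.ofReal_le_ofReal ?_
    refine (hV.integral_sq_posPart_abs_le_exp hab hε hφ hφ2 hmean ht.le).trans_eq ?_
    ring
  rw [← h2, lintegral_rpow_mul_comp_div hε, ← h1, ← mul_assoc, ← mul_assoc,
    ENNReal.mul_le_mul_iff_left hκ0 hκt, ← ENNReal.ofReal_mul (by positivity),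
    ← ENNReal.ofReal_mul (by positivity)] at h3
  refine h3.trans_eq ?_
  congr 1
  ring

lemma le_lintegral_rpow_abs (hp : 1 < p) (hp' : p < 2) (hab : a < b) (hε : 0 < ε)
    (hφ : IntegrableOn φ (Set.Ioo a b)) (hφ2 : IntegrableOn (fun x => φ x ^ 2) (Set.Ioo a b))
    (hV : VarianceLE φ a b ε) (hmean : ∫ x in Set.Ioo a b, φ x = 0) :
    ENNReal.ofReal (Real.Gamma (p + 1) / 2 * ε ^ (p - 2) * ∫ x in Set.Ioo a b, φ x ^ 2) ≤
      ∫⁻ x in Set.Ioo a b, ENNReal.ofReal (|φ x| ^ p) := by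
  set K : ℝ → ℝ → ℝ := fun y t => y ^ 2 - max (y - t) 0 ^ 2 with hK
  have hKm : Measurable (Function.uncurry K) := by
    simp only [hK, Function.uncurry_def]; fun_prop
  have hK0 : ∀ t, 0 < t → K 0 t = 0 := fun t ht => by
    simp only [hK]; rw [max_eq_right (by linarith)]; simp
  have hKhom : ∀ r y t, 0 < r → K (r * y) (r * t) = r ^ 2 * K y t := fun r y t hr => by
    simp only [hK]
    rw [mul_sub, ← mul_pow, ← mul_pow, mul_max_of_nonneg _ _ hr.le]
    ring_nf
  have hp0 : 0 < p := by linarith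
  set κ := ∫⁻ t in Set.Ioi 0, ENNReal.ofReal (t ^ (p - 3)) * ENNReal.ofReal (K 1 t) with hκ
  have hκ0 : κ ≠ 0 := lintegral_kernel_pos hKm fun t h0 h1 => by
    simp only [hK]
    rw [max_eq_left (by linarith)]
    nlinarith
  have hκt : κ ≠ ⊤ := lintegral_sq_sub_sq_posPart_kernel_ne_top hp hp'
  have h1 := Gamma_mul_lintegral_kernel hp0 hKm hK0 hKhom
  obtain ⟨D, hD⟩ : ∃ D : ℝ → ENNReal, ∀ s, D s =
      ∫⁻ y in Set.Ioi 0, ENNReal.ofReal (Real.exp (-y)) * ENNReal.ofReal (K y s) :=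
    ⟨_, fun _ => rfl⟩
  simp_rw [← hD] at h1
  have h2 := lintegral_rpow_mul_eq_lintegral_kernel (μ := volume.restrict (Set.Ioo a b))
    (Y := fun x => |φ x|) hφ.abs.aemeasurable (ae_of_all _ fun x => abs_nonneg _) hp0 hKm hK0 hKhom
  set G := ∫ x in Set.Ioo a b, φ x ^ 2 with hG
  have hG0 : 0 ≤ G := integral_nonneg fun x => sq_nonneg _
  -- The complementary kernel reverses the comparison: the decay bound becomes a lower bound by G(1
  -- - e^{-t/ε}).
  have h3 : ENNReal.ofReal (G / 2) * ∫⁻ t in Set.Ioi 0, ENNReal.ofReal (t ^ (p - 3)) * D (t / ε) ≤ ∫⁻ t in Set.Ioi 0, ENNReal.ofReal (t ^ (p - 3)) *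
      (∫⁻ x in Set.Ioo a b, ENNReal.ofReal (K |φ x| t)) := by
    rw [← lintegral_const_mul' _ _ ENNReal.ofReal_ne_top]
    refine setLIntegral_mono' measurableSet_Ioi fun t (ht : 0 < t) => ?_
    rw [mul_left_comm]
    gcongr
    have hi := integrableOn_sq_posPart_sub hφ.abs (integrableOn_sq_abs hφ2) t
    have hi' : IntegrableOn (fun x => K |φ x| t) (Set.Ioo a b) :=
      Integrable.sub (integrableOn_sq_abs hφ2) hi
    rw [← ofReal_integral_eq_lintegral_ofReal hi' (ae_of_all _ fun x => by
      simp only [hK, Pi.zero_apply, sub_nonneg]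
      gcongr
      exact max_le (by linarith) (abs_nonneg _))]
    simp only [hD, hK]
    rw [lintegral_exp_neg_mul_sq_sub_sq_posPart (by positivity),
      ← ENNReal.ofReal_mul (by positivity)]
    refine ENNReal.ofReal_le_ofReal ?_
    rw [integral_sub (integrableOn_sq_abs hφ2) hi]
    simp only [sq_abs]
    have := hV.integral_sq_posPart_abs_le_exp hab hε hφ hφ2 hmean ht.le
    linarith
  rw [← h2, lintegral_rpow_mul_comp_div hε, ← h1, ← mul_assoc, ← mul_assoc,
    ENNReal.mul_le_mul_iff_left hκ0 hκt, ← ENNReal.ofReal_mul (by positivity),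
    ← ENNReal.ofReal_mul (by positivity)] at h3
  refine Eq.trans_le ?_ h3
  congr 1
  ring

/-- The sharp upper bound for the `p`-th moment, `2 ≤ p`, of a mean-zero function. -/
lemma VarianceLE.integral_rpow_abs_le (hp : 2 ≤ p) (hab : a < b) (hε : 0 < ε)
    (hφ : IntegrableOn φ (Set.Ioo a b)) (hφ2 : IntegrableOn (fun x => φ x ^ 2) (Set.Ioo a b))
    (hV : VarianceLE φ a b ε) (hmean : ∫ x in Set.Ioo a b, φ x = 0) :
    IntegrableOn (fun x => |φ x| ^ p) (Set.Ioo a b) ∧ ∫ x in Set.Ioo a b, |φ x| ^ p ≤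
      Real.Gamma (p + 1) / 2 * ε ^ (p - 2) * ∫ x in Set.Ioo a b, φ x ^ 2 := by
  -- At p = 2 the kernel integral diverges, but the claim is an equality because Γ(3)/2 = 1.
  rcases hp.eq_or_lt with rfl | hp
  · have h3 : Real.Gamma (2 + 1) = 2 := by
      rw [Real.Gamma_add_one two_ne_zero, Real.Gamma_two, mul_one]
    simp only [Real.rpow_two, sq_abs, h3, sub_self, Real.rpow_zero]
    exact ⟨hφ2, by simp⟩
  have hle := lintegral_rpow_abs_le hp hab hε hφ hφ2 hV hmean
  have hnn : 0 ≤ᵐ[volume.restrict (Set.Ioo a b)] fun x => |φ x| ^ p :=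
    ae_of_all _ fun x => by positivity
  have hi : IntegrableOn (fun x => |φ x| ^ p) (Set.Ioo a b) := by
    refine ⟨(hφ.abs.aemeasurable.pow_const p).aestronglyMeasurable, ?_⟩
    rw [hasFiniteIntegral_iff_ofReal hnn]
    exact hle.trans_lt ENNReal.ofReal_lt_top
  refine ⟨hi, ?_⟩
  rw [← ofReal_integral_eq_lintegral_ofReal hi hnn] at hle
  refine (ENNReal.ofReal_le_ofReal_iff ?_).1 hle
  have : 0 ≤ ∫ x in Set.Ioo a b, φ x ^ 2 := integral_nonneg fun x => sq_nonneg _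
  have : 0 < Real.Gamma (p + 1) := Real.Gamma_pos_of_pos (by linarith)
  positivity

/-- The sharp lower bound for the `p`-th moment, `1 ≤ p ≤ 2`, of a mean-zero function. -/
lemma VarianceLE.le_integral_rpow_abs (hp : 1 ≤ p) (hp' : p ≤ 2) (hab : a < b) (hε : 0 < ε)
    (hφ : IntegrableOn φ (Set.Ioo a b)) (hφ2 : IntegrableOn (fun x => φ x ^ 2) (Set.Ioo a b))
    (hV : VarianceLE φ a b ε) (hmean : ∫ x in Set.Ioo a b, φ x = 0) :
    IntegrableOn (fun x => |φ x| ^ p) (Set.Ioo a b) ∧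
      Real.Gamma (p + 1) / 2 * ε ^ (p - 2) * ∫ x in Set.Ioo a b, φ x ^ 2 ≤
        ∫ x in Set.Ioo a b, |φ x| ^ p := by
  have hi : IntegrableOn (fun x => |φ x| ^ p) (Set.Ioo a b) := by
    have hb : IntegrableOn (fun x => 1 + φ x ^ 2) (Set.Ioo a b) :=
      (integrableOn_const (by simp) (by simp)).add hφ2
    refine Integrable.mono' hb (hφ.abs.aemeasurable.pow_const p).aestronglyMeasurable
      (ae_of_all _ fun x => ?_)
    rw [Real.norm_of_nonneg (by positivity)]
    rcases le_total |φ x| 1 with h | h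
    · have := Real.rpow_le_one (abs_nonneg (φ x)) h (by linarith : 0 ≤ p)
      nlinarith [sq_nonneg (φ x)]
    · have := Real.rpow_le_rpow_of_exponent_le h hp'
      rw [Real.rpow_two, sq_abs] at this
      linarith
  refine ⟨hi, ?_⟩
  rcases hp'.eq_or_lt with rfl | hp'
  · have h3 : Real.Gamma (2 + 1) = 2 := by
      rw [Real.Gamma_add_one two_ne_zero, Real.Gamma_two, mul_one]
    simp [h3]
  -- At p = 1 the kernel integral diverges at 0; the claim is the truncation estimate at level t =
  -- 0.
  rcases hp.eq_or_lt with rfl | hp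
  · have h := hV.integral_sq_posPart_abs_le hab hε.le hφ hφ2 hmean le_rfl
    simp only [sub_zero, fun x => max_eq_left (abs_nonneg (φ x)), sq_abs] at h
    rw [Real.Gamma_add_one one_ne_zero, Real.Gamma_one, show (1 : ℝ) - 2 = -1 by norm_num,
      Real.rpow_neg_one]
    simp only [Real.rpow_one]
    rw [mul_one, ← div_eq_mul_inv, div_div, div_mul_eq_mul_div, one_mul,
      div_le_iff₀ (by positivity), mul_comm]
    exact h
  have hle := le_lintegral_rpow_abs hp hp' hab hε hφ hφ2 hV hmean
  have hnn : 0 ≤ᵐ[volume.restrict (Set.Ioo a b)] fun x => |φ x| ^ p :=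
    ae_of_all _ fun x => by positivity
  rw [← ofReal_integral_eq_lintegral_ofReal hi hnn] at hle
  exact (ENNReal.ofReal_le_ofReal_iff (integral_nonneg fun x => by positivity)).1 hle

end

/-! ### From moments to oscillations and the BMO norm. -/

lemma intervalAv_eq {f : ℝ → ℝ} {c d : ℝ} (h : c ≤ d) :
    intervalAv f c d = (d - c)⁻¹ * ∫ x in Set.Ioo c d, f x := by
  rw [intervalAv, setAverage_eq, smul_eq_mul]
  simp [h]

lemma intervalAv_eq_intervalIntegral {f : ℝ → ℝ} {c d : ℝ} (h : c ≤ d) :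
    intervalAv f c d = (d - c)⁻¹ * ∫ x in c..d, f x := by
  rw [intervalAv_eq h, intervalIntegral.integral_of_le h, integral_Ioc_eq_integral_Ioo]

section
variable {φ : ℝ → ℝ} {a b : ℝ}

lemma variance_le_iff {c d C : ℝ} (h : c < d) :
    intervalAv (fun x => φ x ^ 2) c d - intervalAv φ c d ^ 2 ≤ C ^ 2 ↔
      (d - c) * (∫ x in Set.Ioo c d, φ x ^ 2) - (∫ x in Set.Ioo c d, φ x) ^ 2 ≤
        C ^ 2 * (d - c) ^ 2 := by
  have hl : 0 < d - c := sub_pos.2 h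
  rw [intervalAv_eq h.le, intervalAv_eq h.le, ← div_le_iff₀ (by positivity)]
  apply le_iff_le_of_cmp_eq_cmp
  congr 1
  field_simp

/-- Needed because a real `sSup` defaults to 0 on unbounded sets; only with this bound does the norm
dominate each interval's deviation. -/
lemma MemBMO.bddAbove (h : MemBMO φ a b) :
    BddAbove {r : ℝ | ∃ c d : ℝ, a ≤ c ∧ c < d ∧ d ≤ b ∧
      r = Real.sqrt (intervalAv (fun x => φ x ^ 2) c d - intervalAv φ c d ^ 2)} := by
  obtain ⟨_, C, hC⟩ := h
  refine ⟨|C|, ?_⟩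
  rintro r ⟨c, d, hc, hcd, hd, rfl⟩
  rw [← Real.sqrt_sq_eq_abs]
  exact Real.sqrt_le_sqrt (hC c d hc hcd hd).2

lemma bmoNorm_nonneg (φ : ℝ → ℝ) (a b : ℝ) : 0 ≤ bmoNorm φ a b := by
  refine Real.sSup_nonneg ?_
  rintro r ⟨c, d, _, _, _, rfl⟩
  exact Real.sqrt_nonneg _

lemma MemBMO.varianceLE (h : MemBMO φ a b) : VarianceLE φ a b (bmoNorm φ a b) := by
  intro c d hc hcd hd
  rw [← variance_le_iff hcd]
  exact (Real.sqrt_le_iff.1 (le_csSup h.bddAbove ⟨c, d, hc, hcd, hd, rfl⟩)).2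

lemma VarianceLE.mono {ε δ : ℝ} (h : VarianceLE φ a b ε) (hε : 0 ≤ ε) (hεδ : ε ≤ δ) :
    VarianceLE φ a b δ := fun c d hc hcd hd =>
  (h c d hc hcd hd).trans (by gcongr)

lemma MemBMO.integrableOn_sq (h : MemBMO φ a b) (hab : a < b) :
    IntegrableOn (fun x => φ x ^ 2) (Set.Ioo a b) := by
  obtain ⟨_, C, hC⟩ := h
  exact (hC a b le_rfl hab le_rfl).1

lemma VarianceLE.sub_const {ε : ℝ} (h : VarianceLE φ a b ε) (hφ : IntegrableOn φ (Set.Ioo a b))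
    (hφ2 : IntegrableOn (fun x => φ x ^ 2) (Set.Ioo a b)) (m : ℝ) :
    VarianceLE (fun x => φ x - m) a b ε := by
  intro c d hc hcd hd
  have hss : Set.Ioo c d ⊆ Set.Ioo a b := Set.Ioo_subset_Ioo hc hd
  have hφ' := hφ.mono_set hss
  have hφ2' := hφ2.mono_set hss
  have hi : IntegrableOn (fun x => φ x ^ 2 - 2 * m * φ x) (Set.Ioo c d) :=
    Integrable.sub hφ2' (Integrable.const_mul hφ' _)
  have hexp : (fun x => (φ x - m) ^ 2) = fun x => φ x ^ 2 - 2 * m * φ x + m ^ 2 := by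
    ext x; ring
  have hvol : volume.real (Set.Ioo c d) = d - c := by simp [hcd.le]
  rw [hexp, integral_add hi (integrableOn_const (by simp) (by simp)),
    integral_sub hφ2' (Integrable.const_mul hφ' _), integral_const_mul,
    integral_sub hφ' (integrableOn_const (by simp) (by simp)), setIntegral_const,
    setIntegral_const, hvol, smul_eq_mul, smul_eq_mul]
  refine Eq.trans_le ?_ (h c d hc hcd hd)
  ring

lemma integral_sub_intervalAv (hab : a < b) (hφ : IntegrableOn φ (Set.Ioo a b)) :
    ∫ x in Set.Ioo a b, (φ x - intervalAv φ a b) = 0 := by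
  have hl : b - a ≠ 0 := (sub_pos.2 hab).ne'
  rw [integral_sub hφ (integrableOn_const (by simp) (by simp)), setIntegral_const,
    intervalAv_eq hab.le]
  simp [hab.le, hl]

/-- The norm may vanish while the moment bounds need ε > 0. Only integrability is extracted, so norm
+ 1 serves. -/
lemma MemBMO.integrableOn_oscFun_of_le_two {p : ℝ} (h : MemBMO φ a b) (hab : a < b) (hp : 1 ≤ p)
    (hp' : p ≤ 2) : IntegrableOn (oscFun p φ a b) (Set.Ioo a b) :=
  (((h.varianceLE.mono (bmoNorm_nonneg _ _ _) (le_add_of_nonneg_right one_pos.le)).sub_const h.1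
    (h.integrableOn_sq hab) (intervalAv φ a b)).le_integral_rpow_abs hp hp' hab
    (by linarith [bmoNorm_nonneg φ a b]) (h.1.sub (integrableOn_const (by simp) (by simp)))
    (integrableOn_sq_sub h.1 (h.integrableOn_sq hab) _) (integral_sub_intervalAv hab h.1)).1

lemma MemBMO.integrableOn_oscFun_of_two_le {p : ℝ} (h : MemBMO φ a b) (hab : a < b) (hp : 2 ≤ p) :
    IntegrableOn (oscFun p φ a b) (Set.Ioo a b) :=
  (((h.varianceLE.mono (bmoNorm_nonneg _ _ _) (le_add_of_nonneg_right one_pos.le)).sub_const h.1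
    (h.integrableOn_sq hab) (intervalAv φ a b)).integral_rpow_abs_le hp hab
    (by linarith [bmoNorm_nonneg φ a b]) (h.1.sub (integrableOn_const (by simp) (by simp)))
    (integrableOn_sq_sub h.1 (h.integrableOn_sq hab) _) (integral_sub_intervalAv hab h.1)).1

lemma osc_nonneg (p : ℝ) (φ : ℝ → ℝ) (hab : a ≤ b) : 0 ≤ osc p φ a b := by
  rw [osc, intervalAv_eq hab]
  refine mul_nonneg (inv_nonneg.2 (sub_nonneg.2 hab)) (integral_nonneg fun x => ?_)
  simp only [oscFun, Pi.zero_apply]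
  positivity

/-- The sharp upper estimate of `L^p₂` oscillations by `L^p₁` oscillations. -/
lemma MemBMO.osc_le (h : MemBMO φ a b) (hab : a < b) {p₁ p₂ : ℝ} (hp₁ : 1 ≤ p₁) (hp₁' : p₁ ≤ 2)
    (hp₂ : 2 ≤ p₂) :
    osc p₂ φ a b ≤ (p₂ * Real.Gamma p₂) / (p₁ * Real.Gamma p₁) *
        bmoNorm φ a b ^ (p₂ - p₁) * osc p₁ φ a b := by
  have hφ := h.1
  have hφ2 := h.integrableOn_sq hab
  have hl : 0 < b - a := sub_pos.2 hab
  set m := intervalAv φ a b with hm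
  have hψ : IntegrableOn (fun x => φ x - m) (Set.Ioo a b) :=
    hφ.sub (integrableOn_const (by simp) (by simp))
  have hψ2 := integrableOn_sq_sub hφ hφ2 m
  have hV := h.varianceLE.sub_const hφ hφ2 m
  have hmean : ∫ x in Set.Ioo a b, (φ x - m) = 0 := integral_sub_intervalAv hab hφ
  have hg₁ : 0 < Real.Gamma (p₁ + 1) := Real.Gamma_pos_of_pos (by linarith)
  have hg₂ : 0 < Real.Gamma (p₂ + 1) := Real.Gamma_pos_of_pos (by linarith)
  rw [← Real.Gamma_add_one (by linarith), ← Real.Gamma_add_one (by linarith)]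
  have hI0 : 0 ≤ ∫ x in Set.Ioo a b, (φ x - m) ^ 2 := integral_nonneg fun x => sq_nonneg _
  rcases (bmoNorm_nonneg φ a b).eq_or_lt with hN | hN
  -- Norm zero: the second moment vanishes, so the upper moment bound with ε = 1 kills the left
  -- side. The right side is nonnegative whatever the value of 0^(p₂-p₁).
  · have hI : ∫ x in Set.Ioo a b, (φ x - m) ^ 2 = 0 := by
      have := hV a b le_rfl hab le_rfl
      rw [hmean, ← hN] at this
      nlinarith
    have hV1 := hV.mono (hN.le) (hN ▸ zero_le_one)
    have h2 := (hV1.integral_rpow_abs_le hp₂ hab one_pos hψ hψ2 hmean).2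
    rw [hI, mul_zero] at h2
    have h3 : osc p₂ φ a b ≤ 0 := by
      rw [osc, intervalAv_eq hab.le]
      exact mul_nonpos_of_nonneg_of_nonpos (inv_nonneg.2 hl.le) h2
    refine h3.trans (mul_nonneg (mul_nonneg (by positivity) (Real.rpow_nonneg hN.le _))
      (osc_nonneg _ _ hab.le))
  · set N := bmoNorm φ a b
    have h1 := (hV.le_integral_rpow_abs hp₁ hp₁' hab hN hψ hψ2 hmean).2
    have h2 := (hV.integral_rpow_abs_le hp₂ hab hN hψ hψ2 hmean).2
    have hpow : N ^ (p₂ - 2) = N ^ (p₂ - p₁) * N ^ (p₁ - 2) := by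
      rw [← Real.rpow_add hN]; congr 1; ring
    rw [osc, osc, intervalAv_eq hab.le, intervalAv_eq hab.le, mul_left_comm]
    refine mul_le_mul_of_nonneg_left ?_ (inv_nonneg.2 hl.le)
    refine h2.trans ?_
    calc _ = Real.Gamma (p₂ + 1) / Real.Gamma (p₁ + 1) * N ^ (p₂ - p₁) *
          (Real.Gamma (p₁ + 1) / 2 * N ^ (p₁ - 2) * ∫ x in Set.Ioo a b, (φ x - m) ^ 2) := by
          rw [hpow]; field_simp
      _ ≤ _ := mul_le_mul_of_nonneg_left h1 (by positivity)

/-- Jensen's inequality for the convex function x ↦ x^{p₂/p₁}. -/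
lemma osc_rpow_le {p₁ p₂ : ℝ} (hab : a < b) (hp₁ : 0 < p₁) (hp : p₁ ≤ p₂)
    (h₁ : IntegrableOn (oscFun p₁ φ a b) (Set.Ioo a b))
    (h₂ : IntegrableOn (oscFun p₂ φ a b) (Set.Ioo a b)) :
    osc p₁ φ a b ^ (p₂ / p₁) ≤ osc p₂ φ a b := by
  have hcomp : (fun x : ℝ => x ^ (p₂ / p₁)) ∘ oscFun p₁ φ a b = oscFun p₂ φ a b := by
    ext x
    simp only [Function.comp, oscFun]
    rw [← Real.rpow_mul (abs_nonneg _), mul_div_cancel₀ _ hp₁.ne']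
  have h := (convexOn_rpow (p := p₂ / p₁) ((one_le_div hp₁).2 hp)).map_set_average_le
    (μ := volume) (t := Set.Ioo a b) (f := oscFun p₁ φ a b)
    (fun x _ => (Real.continuousAt_rpow_const _ _ (Or.inr
      (by positivity [hp₁.trans_le hp]))).continuousWithinAt)
    isClosed_Ici (by simp [hab]) (by simp)
    (ae_of_all _ fun x => by simp only [Set.mem_Ici, oscFun]; positivity) h₁ (by rwa [hcomp])
  have hcomp' : ∀ x, oscFun p₁ φ a b x ^ (p₂ / p₁) = oscFun p₂ φ a b x := fun x =>
    congrFun hcomp x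
  simp only [hcomp'] at h
  exact h

end

/-! ### Affine transport from (0, 1). -/

section
variable {ψ : ℝ → ℝ} {a b : ℝ}

lemma intervalAv_onInterval (hab : a < b) {c d : ℝ} (hcd : c ≤ d) :
    intervalAv (onInterval ψ a b) c d =
      intervalAv ψ ((c - a) / (b - a)) ((d - a) / (b - a)) := by
  have hl : 0 < b - a := sub_pos.2 hab
  rw [intervalAv_eq_intervalIntegral hcd, intervalAv_eq_intervalIntegral (by gcongr)]
  have h : onInterval ψ a b = fun x => ψ (x / (b - a) - a / (b - a)) := by
    ext x; rw [onInterval, sub_div]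
  rw [h, intervalIntegral.integral_comp_div_sub _ hl.ne', smul_eq_mul, ← sub_div, ← sub_div,
    ← mul_assoc, ← sub_div, sub_sub_sub_cancel_right, inv_div, inv_mul_eq_div]

lemma integrableOn_onInterval (hab : a < b) {c d : ℝ}
    (h : IntegrableOn ψ (Set.Ioo ((c - a) / (b - a)) ((d - a) / (b - a)))) :
    IntegrableOn (onInterval ψ a b) (Set.Ioo c d) := by
  have hl : 0 < b - a := sub_pos.2 hab
  have himg : (fun x => (x - a) / (b - a)) '' Set.Ioo c d =
      Set.Ioo ((c - a) / (b - a)) ((d - a) / (b - a)) := by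
    have := Set.image_affine_Ioo (inv_pos.2 hl) (-(a / (b - a))) c d
    rw [show (fun x => (x - a) / (b - a)) = fun x => (b - a)⁻¹ * x + -(a / (b - a)) by
      ext x; ring, this]
    congr 1 <;> ring
  have := (integrableOn_image_iff_integrableOn_abs_deriv_smul (s := Set.Ioo c d)
    (f := fun x => (x - a) / (b - a)) (f' := fun _ => 1 / (b - a)) measurableSet_Ioo
    (fun x _ => (((hasDerivAt_id x).sub_const a).div_const (b - a)).hasDerivWithinAt)
    (fun x _ y _ hxy => by simpa [div_left_inj' hl.ne'] using hxy) ψ).1 (himg ▸ h)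
  exact (integrable_smul_iff (c := |1 / (b - a)|) (by positivity) (onInterval ψ a b)).1 this

lemma onInterval_endpoints (hab : a < b) : (a - a) / (b - a) = 0 ∧ (b - a) / (b - a) = 1 :=
  ⟨by simp, div_self (sub_pos.2 hab).ne'⟩

lemma osc_onInterval (p : ℝ) (hab : a < b) : osc p (onInterval ψ a b) a b = osc p ψ 0 1 := by
  have h : oscFun p (onInterval ψ a b) a b = onInterval (oscFun p ψ 0 1) a b := by
    ext x
    simp only [oscFun]
    rw [intervalAv_onInterval hab hab.le, (onInterval_endpoints hab).1,
      (onInterval_endpoints hab).2]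
    rfl
  rw [osc, h, intervalAv_onInterval hab hab.le, (onInterval_endpoints hab).1,
      (onInterval_endpoints hab).2, osc]

/-- Subintervals and their averages correspond under the affine map. A variance bound ε² attained on
the whole interval pins the norm to ε. -/
lemma memBMO_onInterval (hab : a < b) {ε : ℝ} (hε : 0 ≤ ε) (hψ : IntegrableOn ψ (Set.Ioo 0 1))
    (hψ2 : IntegrableOn (fun x => ψ x ^ 2) (Set.Ioo 0 1))
    (hV : ∀ c d, 0 ≤ c → c < d → d ≤ 1 →
      intervalAv (fun x => ψ x ^ 2) c d - intervalAv ψ c d ^ 2 ≤ ε ^ 2)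
    (hQ : intervalAv (fun x => ψ x ^ 2) 0 1 - intervalAv ψ 0 1 ^ 2 = ε ^ 2) :
    MemBMO (onInterval ψ a b) a b ∧ bmoNorm (onInterval ψ a b) a b = ε := by
  have hl : 0 < b - a := sub_pos.2 hab
  have hsq : (fun x => onInterval ψ a b x ^ 2) = onInterval (fun x => ψ x ^ 2) a b := rfl
  obtain ⟨e0, e1⟩ := onInterval_endpoints hab
  have hV' : ∀ c d, a ≤ c → c < d → d ≤ b → intervalAv (fun x => onInterval ψ a b x ^ 2) c d -
      intervalAv (onInterval ψ a b) c d ^ 2 ≤ ε ^ 2 := by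
    intro c d hc hcd hd
    rw [hsq, intervalAv_onInterval hab hcd.le, intervalAv_onInterval hab hcd.le]
    refine hV _ _ (div_nonneg (by linarith) hl.le) (by gcongr) ?_
    rw [div_le_one hl]
    linarith
  have hmem : MemBMO (onInterval ψ a b) a b := by
    refine ⟨integrableOn_onInterval hab (by rwa [e0, e1]), ε, fun c d hc hcd hd =>
      ⟨IntegrableOn.mono_set ?_ (Set.Ioo_subset_Ioo hc hd), hV' c d hc hcd hd⟩⟩
    rw [hsq]
    exact integrableOn_onInterval hab (by rwa [e0, e1])
  refine ⟨hmem, le_antisymm ?_ ?_⟩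
  · refine Real.sSup_le ?_ hε
    rintro r ⟨c, d, hc, hcd, hd, rfl⟩
    exact Real.sqrt_le_iff.2 ⟨hε, hV' c d hc hcd hd⟩
  · refine le_csSup hmem.bddAbove ⟨a, b, le_rfl, hab, le_rfl, ?_⟩
    rw [hsq, intervalAv_onInterval hab hab.le, intervalAv_onInterval hab hab.le, e0, e1, hQ,
      Real.sqrt_sq hε]

end

/-! ### The two-valued extremal function. -/

section
variable {ε : ℝ}

lemma measurable_stepOptimizer (ε : ℝ) : Measurable (stepOptimizer ε) :=
  Measurable.ite measurableSet_Iio measurable_const measurable_const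

lemma abs_stepOptimizer (hε : 0 ≤ ε) (t : ℝ) : |stepOptimizer ε t| = ε := by
  unfold stepOptimizer
  split_ifs <;> simp [abs_of_nonneg hε]

lemma intervalAv_const (k : ℝ) {c d : ℝ} (h : c < d) : intervalAv (fun _ => k) c d = k := by
  have : d - c ≠ 0 := (sub_pos.2 h).ne'
  rw [intervalAv_eq h.le, setIntegral_const]
  simp [h.le, this]

/-- A function vanishes in the mean over `(0, 1)` if it is odd about `1 / 2` almost everywhere. -/
lemma intervalAv_eq_zero_of_odd {ψ : ℝ → ℝ} (h : ∀ᵐ t, ψ (1 - t) = -ψ t) :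
    intervalAv ψ 0 1 = 0 := by
  rw [intervalAv_eq_intervalIntegral zero_le_one]
  have h1 : ∫ t in (0 : ℝ)..1, ψ (1 - t) = -∫ t in (0 : ℝ)..1, ψ t := by
    rw [← intervalIntegral.integral_neg]
    exact intervalIntegral.integral_congr_ae (h.mono fun t ht _ => ht)
  rw [intervalIntegral.integral_comp_sub_left, sub_self, sub_zero] at h1
  have : ∫ t in (0 : ℝ)..1, ψ t = 0 := by linarith
  rw [this, mul_zero]

lemma intervalAv_stepOptimizer (ε : ℝ) : intervalAv (stepOptimizer ε) 0 1 = 0 := by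
  refine intervalAv_eq_zero_of_odd ?_
  filter_upwards [Measure.ae_ne volume (1 / 2 : ℝ)] with t ht
  unfold stepOptimizer
  rcases lt_or_gt_of_ne ht with h | h
  · rw [if_pos h, if_neg (by linarith), neg_neg]
  · rw [if_neg (not_lt.2 h.le), if_pos (by linarith)]

lemma stepOptimizer_sq (ε t : ℝ) : stepOptimizer ε t ^ 2 = ε ^ 2 := by
  unfold stepOptimizer
  split_ifs <;> ring

lemma integrableOn_stepOptimizer (hε : 0 ≤ ε) : IntegrableOn (stepOptimizer ε) (Set.Ioo 0 1) := by
  refine Integrable.mono' (g := fun _ => ε) (integrableOn_const (by simp) (by simp))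
    (measurable_stepOptimizer ε).aestronglyMeasurable (ae_of_all _ fun t => ?_)
  rw [Real.norm_eq_abs, abs_stepOptimizer hε]

lemma memBMO_stepOptimizer {a b : ℝ} (hab : a < b) (hε : 0 ≤ ε) :
    MemBMO (onInterval (stepOptimizer ε) a b) a b ∧
      bmoNorm (onInterval (stepOptimizer ε) a b) a b = ε := by
  refine memBMO_onInterval hab hε (integrableOn_stepOptimizer hε) ?_ ?_ ?_
  · simp only [stepOptimizer_sq]
    exact integrableOn_const (by simp) (by simp)
  · intro c d _ hcd _
    simp only [stepOptimizer_sq, intervalAv_const _ hcd]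
    linarith [sq_nonneg (intervalAv (stepOptimizer ε) c d)]
  · simp only [stepOptimizer_sq, intervalAv_const _ zero_lt_one, intervalAv_stepOptimizer]
    ring

lemma osc_stepOptimizer {a b : ℝ} (hab : a < b) (hε : 0 ≤ ε) (p : ℝ) :
    osc p (onInterval (stepOptimizer ε) a b) a b = ε ^ p := by
  have h : oscFun p (stepOptimizer ε) 0 1 = fun _ => ε ^ p := by
    ext t
    rw [oscFun, intervalAv_stepOptimizer, sub_zero, abs_stepOptimizer hε]
  rw [osc_onInterval p hab, osc, h, intervalAv_const _ zero_lt_one]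

end

/-! ### The logarithmic extremal function. -/

/-- The moments of `-log (4 t)` on `(0, 1 / 4)`. -/
lemma integral_abs_log_four_mul_rpow {p : ℝ} (hp : 0 < p) :
    IntegrableOn (fun t => |Real.log (4 * t)| ^ p) (Set.Ioo 0 (1 / 4)) ∧
      ∫ t in Set.Ioo (0 : ℝ) (1 / 4), |Real.log (4 * t)| ^ p = Real.Gamma (p + 1) / 4 := by
  -- The substitution t = e^{-x}/4 turns Lebesgue measure on (0, 1/4) into a quarter of the
  -- exponential law.
  have himg : (fun x => Real.exp (-x) / 4) '' Set.Ioi 0 = Set.Ioo 0 (1 / 4) := by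
    ext t
    constructor
    · rintro ⟨x, hx, rfl⟩
      have : Real.exp (-x) < 1 := Real.exp_lt_one_iff.2 (neg_lt_zero.2 hx)
      exact ⟨by positivity, by simp only; linarith⟩
    · rintro ⟨h0, h1⟩
      refine ⟨-Real.log (4 * t), neg_pos.2 (Real.log_neg (by linarith) (by linarith)), ?_⟩
      simp only
      rw [neg_neg, Real.exp_log (by linarith)]
      ring
  have hder : ∀ x ∈ Set.Ioi (0 : ℝ), HasDerivWithinAt (fun x => Real.exp (-x) / 4)
      (Real.exp (-x) * -1 / 4) (Set.Ioi 0) x := fun x _ =>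
    ((hasDerivAt_neg x).exp.div_const 4).hasDerivWithinAt
  have hinj : Set.InjOn (fun x => Real.exp (-x) / 4) (Set.Ioi 0) := fun x _ y _ hxy => by
    simp only at hxy
    have : Real.exp (-x) = Real.exp (-y) := by linarith
    simpa using Real.exp_injective this
  have hfun : ∀ x ∈ Set.Ioi (0 : ℝ), |Real.exp (-x) * -1 / 4| •
      |Real.log (4 * (Real.exp (-x) / 4))| ^ p =
        (1 / 4) * (Real.exp (-x) * x ^ (p + 1 - 1)) := by
    intro x (hx : 0 < x)
    rw [mul_div_cancel₀ _ (four_ne_zero), Real.log_exp, abs_neg, abs_of_pos hx, mul_neg_one,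
      neg_div, abs_neg, abs_of_pos (by positivity), smul_eq_mul, add_sub_cancel_right]
    ring
  have hg := (Real.GammaIntegral_convergent (s := p + 1) (by linarith)).const_mul (1 / 4)
  constructor
  · rw [← himg, integrableOn_image_iff_integrableOn_abs_deriv_smul measurableSet_Ioi hder hinj]
    exact IntegrableOn.congr_fun hg (fun x hx => (hfun x hx).symm) measurableSet_Ioi
  · rw [← himg, integral_image_eq_integral_abs_deriv_smul measurableSet_Ioi hder hinj,
      setIntegral_congr_fun measurableSet_Ioi hfun, integral_const_mul,
      ← Real.Gamma_eq_integral (by linarith)]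
    ring

/-- This is the primitive of (log t + h)² up to the endpoint 0. The delicate term is t log² t = 4(√t
log √t)². -/
lemma continuousOn_mul_log_add_sq (h : ℝ) :
    ContinuousOn (fun t => t * ((Real.log t - 1 + h) ^ 2 + 1)) (Set.Ici 0) := by
  have hc : Continuous fun t : ℝ => 4 * (Real.sqrt t * Real.log (Real.sqrt t)) ^ 2 +
      2 * (h - 1) * (t * Real.log t) + ((h - 1) ^ 2 + 1) * t :=
    ((continuous_const.mul ((Real.continuous_mul_log.comp Real.continuous_sqrt).pow 2)).add
      (continuous_const.mul Real.continuous_mul_log)).add (continuous_const.mul continuous_id)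
  refine hc.continuousOn.congr fun t (ht : 0 ≤ t) => ?_
  simp only
  rw [Real.log_sqrt ht, mul_pow, Real.sq_sqrt ht]
  ring

lemma integral_log_add_sq {c e : ℝ} (hc : 0 ≤ c) (hce : c ≤ e) (h : ℝ) :
    ∫ t in Set.Ioo c e, (Real.log t + h) ^ 2 =
      e * ((Real.log e - 1 + h) ^ 2 + 1) - c * ((Real.log c - 1 + h) ^ 2 + 1) := by
  have hcont := (continuousOn_mul_log_add_sq h).mono
    (show Set.Icc c e ⊆ Set.Ici 0 from fun t ht => hc.trans ht.1)
  have hder : ∀ t ∈ Set.Ioo c e, HasDerivAt (fun t => t * ((Real.log t - 1 + h) ^ 2 + 1))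
      ((Real.log t + h) ^ 2) t := by
    intro t ht
    have ht0 : t ≠ 0 := (hc.trans_lt ht.1).ne'
    have h1 := (((Real.hasDerivAt_log ht0).sub_const 1).add_const h).pow 2
    convert! (hasDerivAt_id t).mul (h1.add_const 1) using 1
    simp
    field_simp
    ring
  have hi := intervalIntegral.integrableOn_deriv_of_nonneg hcont hder fun t _ => sq_nonneg _
  rw [← integral_Ioc_eq_integral_Ioo, ← intervalIntegral.integral_of_le hce,
    intervalIntegral.integral_eq_sub_of_hasDerivAt_of_le hce hcont hder
      ((intervalIntegrable_iff_integrableOn_Ioc_of_le hce).2 hi)]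

lemma measurable_logOptimizer (ε : ℝ) : Measurable (logOptimizer ε) := by
  refine Measurable.ite measurableSet_Iio (by fun_prop) ?_
  exact Measurable.ite measurableSet_Iic measurable_const (by fun_prop)

lemma logOptimizer_eq_mul (ε t : ℝ) : logOptimizer ε t = ε * logOptimizer 1 t := by
  unfold logOptimizer
  split_ifs <;> ring

lemma logOptimizer_one_sub (ε t : ℝ) : logOptimizer ε (1 - t) = -logOptimizer ε t := by
  unfold logOptimizer
  by_cases h1 : t < 1 / 4
  · rw [if_pos h1, if_neg (by linarith), if_neg (by linarith)]
    ring_nf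
  · rw [if_neg h1]
    by_cases h2 : t ≤ 3 / 4
    · rw [if_pos h2, if_neg (by linarith), if_pos (by linarith), neg_zero]
    · rw [if_neg h2, if_pos (by linarith)]
      ring_nf

lemma logOptimizer_of_lt {t : ℝ} (h : t < 1 / 4) : logOptimizer 1 t = Real.log (4 * t) := by
  rw [logOptimizer, if_pos h, one_mul]

lemma logOptimizer_of_mid {t : ℝ} (h : 1 / 4 ≤ t) (h' : t ≤ 3 / 4) : logOptimizer 1 t = 0 := by
  rw [logOptimizer, if_neg (not_lt.2 h), if_pos h']

/-- Reflection about `1 / 2`. -/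
lemma setIntegral_comp_one_sub (f : ℝ → ℝ) {c d : ℝ} (h : c ≤ d) :
    ∫ t in Set.Ioo c d, f (1 - t) = ∫ t in Set.Ioo (1 - d) (1 - c), f t := by
  rw [← integral_Ioc_eq_integral_Ioo, ← integral_Ioc_eq_integral_Ioo,
    ← intervalIntegral.integral_of_le h, ← intervalIntegral.integral_of_le (by linarith),
    intervalIntegral.integral_comp_sub_left]

lemma integrableOn_comp_one_sub {f : ℝ → ℝ} {c d : ℝ}
    (h : IntegrableOn f (Set.Ioo (1 - d) (1 - c))) :
    IntegrableOn (fun t => f (1 - t)) (Set.Ioo c d) := by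
  have himg : (fun t : ℝ => 1 - t) '' Set.Ioo c d = Set.Ioo (1 - d) (1 - c) :=
    Set.image_const_sub_Ioo _ _ _
  have := (integrableOn_image_iff_integrableOn_abs_deriv_smul (s := Set.Ioo c d)
    (f := fun t => 1 - t) (f' := fun _ => -1) measurableSet_Ioo
    (fun x _ => ((hasDerivAt_id x).const_sub 1).hasDerivWithinAt)
    (fun x _ y _ hxy => by simpa using hxy) f).1 (himg ▸ h)
  simpa using this

lemma setIntegral_Ioo_split {f : ℝ → ℝ} {c e d : ℝ} (hf : IntegrableOn f (Set.Ioo c d))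
    (hce : c ≤ e) (hed : e ≤ d) :
    ∫ t in Set.Ioo c d, f t = (∫ t in Set.Ioo c e, f t) + ∫ t in Set.Ioo e d, f t := by
  have h1 := hf.mono_set (Set.Ioo_subset_Ioo_right hed)
  have h2 := hf.mono_set (Set.Ioo_subset_Ioo_left hce)
  simp only [← integral_Ioc_eq_integral_Ioo, ← intervalIntegral.integral_of_le, hce, hed,
    hce.trans hed]
  refine (intervalIntegral.integral_add_adjacent_intervals ?_ ?_).symm
  · exact (intervalIntegrable_iff_integrableOn_Ioo_of_le hce).2 h1
  · exact (intervalIntegrable_iff_integrableOn_Ioo_of_le hed).2 h2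

lemma integrableOn_Ioo_of_split {f : ℝ → ℝ} {c e d : ℝ} (hce : c ≤ e) (hed : e ≤ d)
    (h1 : IntegrableOn f (Set.Ioo c e)) (h2 : IntegrableOn f (Set.Ioo e d)) :
    IntegrableOn f (Set.Ioo c d) := by
  rw [← intervalIntegrable_iff_integrableOn_Ioo_of_le (hce.trans hed)]
  exact ((intervalIntegrable_iff_integrableOn_Ioo_of_le hce).2 h1).trans
    ((intervalIntegrable_iff_integrableOn_Ioo_of_le hed).2 h2)

lemma integral_abs_logOptimizer_rpow {p : ℝ} (hp : 0 < p) :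
    IntegrableOn (fun t => |logOptimizer 1 t| ^ p) (Set.Ioo 0 1) ∧
      ∫ t in Set.Ioo (0 : ℝ) 1, |logOptimizer 1 t| ^ p = Real.Gamma (p + 1) / 2 := by
  obtain ⟨hi, he⟩ := integral_abs_log_four_mul_rpow hp
  have hl : ∀ t ∈ Set.Ioo (0 : ℝ) (1 / 4), |Real.log (4 * t)| ^ p = |logOptimizer 1 t| ^ p :=
    fun t ht => by rw [logOptimizer_of_lt ht.2]
  have hi1 : IntegrableOn (fun t => |logOptimizer 1 t| ^ p) (Set.Ioo 0 (1 / 4)) :=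
    hi.congr_fun hl measurableSet_Ioo
  have he1 : ∫ t in Set.Ioo (0 : ℝ) (1 / 4), |logOptimizer 1 t| ^ p = Real.Gamma (p + 1) / 4 := by
    rw [← he]; exact (setIntegral_congr_fun measurableSet_Ioo hl).symm
  have hm : ∀ t ∈ Set.Ioo (1 / 4 : ℝ) (3 / 4), 0 = |logOptimizer 1 t| ^ p := fun t ht => by
    rw [logOptimizer_of_mid ht.1.le ht.2.le, abs_zero, Real.zero_rpow hp.ne']
  have hi2 : IntegrableOn (fun t => |logOptimizer 1 t| ^ p) (Set.Ioo (1 / 4) (3 / 4)) :=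
    integrableOn_zero.congr_fun hm measurableSet_Ioo
  have he2 : ∫ t in Set.Ioo (1 / 4 : ℝ) (3 / 4), |logOptimizer 1 t| ^ p = 0 := by
    rw [← setIntegral_congr_fun measurableSet_Ioo hm]; simp
  have hrefl : (fun t => |logOptimizer 1 t| ^ p) = fun t => |logOptimizer 1 (1 - t)| ^ p := by
    ext t; rw [logOptimizer_one_sub, abs_neg]
  have hi3 : IntegrableOn (fun t => |logOptimizer 1 t| ^ p) (Set.Ioo (3 / 4) 1) := by
    rw [hrefl]
    refine integrableOn_comp_one_sub (f := fun t => |logOptimizer 1 t| ^ p) ?_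
    norm_num at hi1 ⊢
    exact hi1
  have he3 : ∫ t in Set.Ioo (3 / 4 : ℝ) 1, |logOptimizer 1 t| ^ p = Real.Gamma (p + 1) / 4 := by
    rw [hrefl, setIntegral_comp_one_sub (fun t => |logOptimizer 1 t| ^ p) (by norm_num), ← he1]
    norm_num
  have hi23 := integrableOn_Ioo_of_split (by norm_num) (by norm_num) hi2 hi3
  have hi123 := integrableOn_Ioo_of_split (by norm_num) (by norm_num) hi1 hi23
  refine ⟨hi123, ?_⟩
  rw [setIntegral_Ioo_split hi123 (e := 1 / 4) (by norm_num) (by norm_num),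
    setIntegral_Ioo_split hi23 (e := 3 / 4) (by norm_num) (by norm_num), he1, he2, he3]
  ring

lemma integrableOn_logOptimizer : IntegrableOn (logOptimizer 1) (Set.Ioo 0 1) := by
  have h := (integral_abs_logOptimizer_rpow one_pos).1
  simp only [Real.rpow_one] at h
  exact (integrable_norm_iff (measurable_logOptimizer 1).aestronglyMeasurable).1 h

lemma integrableOn_logOptimizer_sq : IntegrableOn (fun t => logOptimizer 1 t ^ 2) (Set.Ioo 0 1) := by
  have h := (integral_abs_logOptimizer_rpow two_pos).1
  simpa only [Real.rpow_two, sq_abs] using h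

lemma integral_logOptimizer_sub_sq_left {c e : ℝ} (hc : 0 ≤ c) (hce : c < e) (he : e ≤ 1 / 4)
    (m : ℝ) : ∫ t in Set.Ioo c e, (logOptimizer 1 t - m) ^ 2 ≤
      e * ((Real.log (4 * e) - 1 - m) ^ 2 + 1) - c := by
  have h : ∫ t in Set.Ioo c e, (logOptimizer 1 t - m) ^ 2 =
      ∫ t in Set.Ioo c e, (Real.log t + (Real.log 4 - m)) ^ 2 := by
    refine setIntegral_congr_fun measurableSet_Ioo fun t ht => ?_
    rw [logOptimizer_of_lt (ht.2.trans_le he), Real.log_mul four_ne_zero (hc.trans_lt ht.1).ne']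
    ring
  rw [h, integral_log_add_sq hc hce.le, Real.log_mul four_ne_zero (hc.trans_lt hce).ne']
  have : 0 ≤ c * (Real.log c - 1 + (Real.log 4 - m)) ^ 2 := by positivity
  nlinarith

lemma integral_logOptimizer_sub_sq_mid {c e : ℝ} (hc : 1 / 4 ≤ c) (hce : c ≤ e) (he : e ≤ 3 / 4)
    (m : ℝ) : ∫ t in Set.Ioo c e, (logOptimizer 1 t - m) ^ 2 = (e - c) * m ^ 2 := by
  rw [setIntegral_congr_fun (g := fun _ => m ^ 2) measurableSet_Ioo fun t ht => ?_,
    setIntegral_const]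
  · simp [hce]
  · simp only
    rw [logOptimizer_of_mid (hc.trans ht.1.le) (ht.2.le.trans he)]
    ring

/-- The variance never exceeds the mean square deviation from any m, so an exact mean is not needed.
The m chosen for intervals meeting the left logarithmic piece is the mean over (0, d). -/
lemma exists_integral_logOptimizer_sub_sq_le_of_le {c d : ℝ} (hc : 0 ≤ c) (hcd : c < d)
    (hd : d ≤ 3 / 4) : ∃ m, ∫ t in Set.Ioo c d, (logOptimizer 1 t - m) ^ 2 ≤ d - c := by
  rcases le_or_gt d (1 / 4) with hd' | hd'
  · refine ⟨Real.log (4 * d) - 1, (integral_logOptimizer_sub_sq_left hc hcd hd' _).trans_eq ?_⟩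
    ring
  rcases le_or_gt (1 / 4) c with hc' | hc'
  · refine ⟨0, (integral_logOptimizer_sub_sq_mid hc' hcd.le hd _).trans_le ?_⟩
    nlinarith
  · refine ⟨-(1 / (4 * d)), ?_⟩
    have hi := (integrableOn_sq_sub integrableOn_logOptimizer integrableOn_logOptimizer_sq
      (-(1 / (4 * d)))).mono_set (Set.Ioo_subset_Ioo hc (hd.trans (by norm_num)))
    rw [setIntegral_Ioo_split hi hc'.le hd'.le,
      integral_logOptimizer_sub_sq_mid le_rfl hd'.le hd]
    have h := integral_logOptimizer_sub_sq_left hc hc' le_rfl (-(1 / (4 * d)))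
    have e : Real.log (4 * (1 / 4)) = 0 := by norm_num
    rw [e] at h
    refine (add_le_add_left h _).trans ?_
    have hd0 : 0 < d := hc.trans_lt hcd
    have : (d - 1 / 4) * (-(1 / (4 * d))) ^ 2 + (1 / 4 * ((0 - 1 - -(1 / (4 * d))) ^ 2 + 1) - c) =
        d - c - (4 * d - 1) ^ 2 / (16 * d) - 0 := by
      field_simp
      ring
    have : 0 ≤ (4 * d - 1) ^ 2 / (16 * d) := by positivity
    linarith

lemma exists_integral_logOptimizer_sub_sq_le {c d : ℝ} (hc : 0 ≤ c) (hcd : c < d) (hd : d ≤ 1) :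
    ∃ m, ∫ t in Set.Ioo c d, (logOptimizer 1 t - m) ^ 2 ≤ d - c := by
  rcases le_or_gt d (3 / 4) with hd' | hd'
  · exact exists_integral_logOptimizer_sub_sq_le_of_le hc hcd hd'
  have hrefl : ∀ m c d, c ≤ d → ∫ t in Set.Ioo c d, (logOptimizer 1 t - m) ^ 2 =
      ∫ t in Set.Ioo (1 - d) (1 - c), (logOptimizer 1 t - -m) ^ 2 := by
    intro m c d h
    rw [← setIntegral_comp_one_sub (fun t => (logOptimizer 1 t - -m) ^ 2) h]
    refine integral_congr_ae (ae_of_all _ fun t => ?_)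
    simp only
    rw [logOptimizer_one_sub]
    ring
  rcases le_or_gt (1 / 4) c with hc' | hc'
  · obtain ⟨m, hm⟩ := exists_integral_logOptimizer_sub_sq_le_of_le (c := 1 - d) (d := 1 - c)
      (by linarith) (by linarith) (by linarith)
    refine ⟨-m, ?_⟩
    rw [hrefl _ _ _ hcd.le, neg_neg]
    linarith
  -- Here the interval meets both logarithmic pieces. With m = 0 they contribute at most 1/2-c and
  -- 1/2-(1-d), and the flat middle contributes nothing; the sum is d-c.
  · refine ⟨0, ?_⟩
    have hi := (integrableOn_sq_sub integrableOn_logOptimizer integrableOn_logOptimizer_sq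
      0).mono_set (Set.Ioo_subset_Ioo hc hd)
    have h1 := integral_logOptimizer_sub_sq_left hc hc' le_rfl 0
    have h2 := integral_logOptimizer_sub_sq_left (c := 1 - d) (e := 1 / 4) (by linarith)
      (by linarith) le_rfl 0
    have h3 := integral_logOptimizer_sub_sq_mid (c := 1 / 4) (e := 3 / 4) le_rfl (by norm_num)
      le_rfl 0
    have h4 := hrefl 0 (3 / 4) d hd'.le
    have e : Real.log (4 * (1 / 4)) = 0 := by norm_num
    rw [e] at h1 h2
    rw [neg_zero, show (1 : ℝ) - 3 / 4 = 1 / 4 by norm_num] at h4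
    rw [setIntegral_Ioo_split hi hc'.le (by linarith),
      setIntegral_Ioo_split (hi.mono_set (Set.Ioo_subset_Ioo_left hc'.le)) (e := 3 / 4)
        (by norm_num) hd'.le, h3, h4]
    linarith

lemma variance_logOptimizer_le {c d : ℝ} (hc : 0 ≤ c) (hcd : c < d) (hd : d ≤ 1) :
    intervalAv (fun t => logOptimizer 1 t ^ 2) c d - intervalAv (logOptimizer 1) c d ^ 2 ≤ 1 := by
  obtain ⟨m, hm⟩ := exists_integral_logOptimizer_sub_sq_le hc hcd hd
  have hss : Set.Ioo c d ⊆ Set.Ioo 0 1 := Set.Ioo_subset_Ioo hc hd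
  have h1 := integrableOn_logOptimizer.mono_set hss
  have h2 := integrableOn_logOptimizer_sq.mono_set hss
  have hi : IntegrableOn (fun t => logOptimizer 1 t ^ 2 - 2 * m * logOptimizer 1 t)
      (Set.Ioo c d) := Integrable.sub h2 (Integrable.const_mul h1 _)
  have hexp : (fun t => (logOptimizer 1 t - m) ^ 2) =
      fun t => logOptimizer 1 t ^ 2 - 2 * m * logOptimizer 1 t + m ^ 2 := by
    ext t; ring
  have hvol : volume.real (Set.Ioo c d) = d - c := by simp [hcd.le]
  rw [hexp, integral_add hi (integrableOn_const (by simp) (by simp)),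
    integral_sub h2 (Integrable.const_mul h1 _), integral_const_mul, setIntegral_const, hvol,
    smul_eq_mul] at hm
  have hl : 0 < d - c := sub_pos.2 hcd
  have h := (variance_le_iff (φ := logOptimizer 1) (C := 1) hcd).2 ?_
  · simpa using h
  · nlinarith [sq_nonneg ((∫ t in Set.Ioo c d, logOptimizer 1 t) - m * (d - c)),
      mul_le_mul_of_nonneg_left hm hl.le]

lemma intervalAv_logOptimizer (ε : ℝ) : intervalAv (logOptimizer ε) 0 1 = 0 :=
  intervalAv_eq_zero_of_odd (ae_of_all _ (logOptimizer_one_sub ε))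

lemma intervalAv_const_mul (k : ℝ) (f : ℝ → ℝ) {c d : ℝ} (h : c ≤ d) :
    intervalAv (fun x => k * f x) c d = k * intervalAv f c d := by
  rw [intervalAv_eq h, intervalAv_eq h, integral_const_mul, mul_left_comm]

lemma osc_logOptimizer {a b : ℝ} (hab : a < b) {ε p : ℝ} (hε : 0 ≤ ε) (hp : 0 < p) :
    osc p (onInterval (logOptimizer ε) a b) a b = ε ^ p * (Real.Gamma (p + 1) / 2) := by
  have h : oscFun p (logOptimizer ε) 0 1 = fun t => ε ^ p * |logOptimizer 1 t| ^ p := by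
    ext t
    rw [oscFun, intervalAv_logOptimizer, sub_zero, logOptimizer_eq_mul, abs_mul,
      abs_of_nonneg hε, Real.mul_rpow hε (abs_nonneg _)]
  rw [osc_onInterval p hab, osc, h, intervalAv_const_mul _ _ zero_le_one,
    intervalAv_eq zero_le_one, (integral_abs_logOptimizer_rpow hp).2]
  simp

lemma memBMO_logOptimizer {a b : ℝ} (hab : a < b) {ε : ℝ} (hε : 0 ≤ ε) :
    MemBMO (onInterval (logOptimizer ε) a b) a b ∧
      bmoNorm (onInterval (logOptimizer ε) a b) a b = ε := by
  have h1 : logOptimizer ε = fun t => ε * logOptimizer 1 t := funext (logOptimizer_eq_mul ε)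
  have h2 : (fun t => logOptimizer ε t ^ 2) = fun t => ε ^ 2 * logOptimizer 1 t ^ 2 := by
    ext t; rw [logOptimizer_eq_mul, mul_pow]
  refine memBMO_onInterval hab hε ?_ ?_ ?_ ?_
  · rw [h1]; exact Integrable.const_mul integrableOn_logOptimizer _
  · rw [h2]; exact Integrable.const_mul integrableOn_logOptimizer_sq _
  · intro c d hc hcd hd
    rw [h2, h1, intervalAv_const_mul _ _ hcd.le, intervalAv_const_mul _ _ hcd.le]
    nlinarith [mul_le_mul_of_nonneg_left (variance_logOptimizer_le hc hcd hd) (sq_nonneg ε)]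
  · have h3 : Real.Gamma (2 + 1) = 2 := by
      rw [Real.Gamma_add_one two_ne_zero, Real.Gamma_two, mul_one]
    have h4 := (integral_abs_logOptimizer_rpow two_pos).2
    simp only [Real.rpow_two, sq_abs] at h4
    rw [h2, intervalAv_logOptimizer, intervalAv_const_mul _ _ zero_le_one,
      intervalAv_eq zero_le_one, h4, h3]
    norm_num

/-! ### The inequalities, their sharpness and the extremal functions. -/

theorem theorem3 (a b : ℝ) (hab : a < b) (p₁ p₂ : ℝ) (hp₁ : 1 ≤ p₁) (hp₁' : p₁ ≤ 2)
    (hp₂ : 2 ≤ p₂) :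
    -- finiteness of the oscillations and the two inequalities
    (∀ φ : ℝ → ℝ, MemBMO φ a b →
      IntegrableOn (oscFun p₁ φ a b) (Set.Ioo a b) ∧
      IntegrableOn (oscFun p₂ φ a b) (Set.Ioo a b) ∧
      osc p₁ φ a b ^ (p₂ / p₁) ≤ osc p₂ φ a b ∧
      osc p₂ φ a b ≤ (p₂ * Real.Gamma p₂) / (p₁ * Real.Gamma p₁) *
        bmoNorm φ a b ^ (p₂ - p₁) * osc p₁ φ a b) ∧
    -- the constants are the best possible
    IsGreatest {c : ℝ | ∀ φ : ℝ → ℝ, MemBMO φ a b →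
      c * osc p₁ φ a b ^ (p₂ / p₁) ≤ osc p₂ φ a b} 1 ∧
    IsLeast {C : ℝ | ∀ φ : ℝ → ℝ, MemBMO φ a b →
      osc p₂ φ a b ≤ C * bmoNorm φ a b ^ (p₂ - p₁) * osc p₁ φ a b}
      ((p₂ * Real.Gamma p₂) / (p₁ * Real.Gamma p₁)) ∧
    -- both inequalities are attained, by functions of any prescribed positive norm
    (∀ ε : ℝ, 0 < ε →
      (MemBMO (onInterval (stepOptimizer ε) a b) a b ∧
        bmoNorm (onInterval (stepOptimizer ε) a b) a b = ε ∧
        osc p₁ (onInterval (stepOptimizer ε) a b) a b ^ (p₂ / p₁) =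
          osc p₂ (onInterval (stepOptimizer ε) a b) a b) ∧
      (MemBMO (onInterval (logOptimizer ε) a b) a b ∧
        bmoNorm (onInterval (logOptimizer ε) a b) a b = ε ∧
        osc p₂ (onInterval (logOptimizer ε) a b) a b =
          (p₂ * Real.Gamma p₂) / (p₁ * Real.Gamma p₁) *
            bmoNorm (onInterval (logOptimizer ε) a b) a b ^ (p₂ - p₁) *
            osc p₁ (onInterval (logOptimizer ε) a b) a b)) := by
  have hp₁0 : 0 < p₁ := by linarith
  have hp₂0 : 0 < p₂ := by linarith
  have hleft : ∀ φ : ℝ → ℝ, MemBMO φ a b → osc p₁ φ a b ^ (p₂ / p₁) ≤ osc p₂ φ a b :=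
    fun φ h => osc_rpow_le hab hp₁0 (hp₁'.trans hp₂) (h.integrableOn_oscFun_of_le_two hab hp₁ hp₁')
      (h.integrableOn_oscFun_of_two_le hab hp₂)
  have hstep : ∀ ε : ℝ, 0 ≤ ε → osc p₁ (onInterval (stepOptimizer ε) a b) a b ^ (p₂ / p₁) =
      osc p₂ (onInterval (stepOptimizer ε) a b) a b := fun ε hε => by
    rw [osc_stepOptimizer hab hε, osc_stepOptimizer hab hε, ← Real.rpow_mul hε,
      mul_div_cancel₀ _ hp₁0.ne']
  refine ⟨fun φ h => ⟨h.integrableOn_oscFun_of_le_two hab hp₁ hp₁',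
    h.integrableOn_oscFun_of_two_le hab hp₂, hleft φ h, h.osc_le hab hp₁ hp₁' hp₂⟩,
    ⟨fun φ h => by rw [one_mul]; exact hleft φ h, fun c hc => ?_⟩,
    ⟨fun φ h => h.osc_le hab hp₁ hp₁' hp₂, fun C hC => ?_⟩,
    fun ε hε => ⟨⟨(memBMO_stepOptimizer hab hε.le).1, (memBMO_stepOptimizer hab hε.le).2,
      hstep ε hε.le⟩, (memBMO_logOptimizer hab hε.le).1, (memBMO_logOptimizer hab hε.le).2, ?_⟩⟩
  · have h := hc _ (memBMO_stepOptimizer hab zero_le_one).1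
    rw [hstep 1 zero_le_one, osc_stepOptimizer hab zero_le_one, Real.one_rpow, mul_one] at h
    exact h
  -- For ε = 1 the logarithmic function has norm 1 and moments Γ(p+1)/2, so an admissible C is at
  -- least the ratio of the two moments.
  · obtain ⟨hm, hn⟩ := memBMO_logOptimizer hab zero_le_one
    have h := hC _ hm
    have hg : 0 < Real.Gamma (p₁ + 1) := Real.Gamma_pos_of_pos (by linarith)
    rw [hn, osc_logOptimizer hab zero_le_one hp₁0, osc_logOptimizer hab zero_le_one hp₂0,
      Real.one_rpow, Real.one_rpow, Real.one_rpow] at h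
    rw [← Real.Gamma_add_one hp₁0.ne', ← Real.Gamma_add_one hp₂0.ne', div_le_iff₀ hg]
    linarith
  · have hg : 0 < Real.Gamma (p₁ + 1) := Real.Gamma_pos_of_pos (by linarith)
    rw [(memBMO_logOptimizer hab hε.le).2, osc_logOptimizer hab hε.le hp₁0,
      osc_logOptimizer hab hε.le hp₂0, ← Real.Gamma_add_one hp₁0.ne',
      ← Real.Gamma_add_one hp₂0.ne', Real.rpow_sub hε]
    field_simp
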